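/- **Definitions.** Fix an arbitrary field $\mathbb F$. For a poset $P$, an *interval* of $P$ is a nonempty, convex subset any two of whose elements are joined within it by a finite sequence of consecutively comparable elements; $\mathrm{Int}(P)$ is the set of intervals. A *$P$-module* is a functor from $P$ to finite-dimensional $\mathbb F$-vector spaces. Its *generalized rank invariant* $\mathrm{rk}_M(I)$, $I\in\mathrm{Int}(P)$, is the rank of the canonical map $\varprojlim M|_I\to\varinjlim M|_I$. Its *generalized persistence diagram* (GPD), which is unique if it exists, is the function $\mathrm{dgm}_M:\mathrm{Int}(P)\to\mathbb Z$ with $\mathrm{rk}_M(I)=\sum_{J\supseteq I}\mathrm{dgm}_M(J)$ for all $I\in\mathrm{Int}(P)$, each sum having only finitely many nonzero terms. Its *size* $\|\mathrm{dgm}_M\|$ is the cardinality of its support. For a finite metric space $(X,\mathsf d)$ and $r\ge 0$, $\mathrm{Rips}(X)_r$ is the simplicial complex of nonempty subsets of $X$ of diameter at most $r$. For a finite subset $X$ of $\mathbb R^3$ with the supremum metric, $\check{\mathrm C}\mathrm{ech}(X)_r$ is the complex of nonempty subsets of $X$ whose closed $r$-balls in $\mathbb R^3$ have a common point. For $d\in\mathbb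 Z$, the degree-Rips complex $\mathrm{DRips}(X)_{d,r}$ (degree-Čech complex $\mathrm{D}\check{\mathrm C}\mathrm{ech}(X)_{d,r}$) is the maximal subcomplex of $\mathrm{Rips}(X)_r$ (of $\check{\mathrm C}\mathrm{ech}(X)_r$) all of whose vertices have degree at least $d-1$ in the 1-skeleton of $\mathrm{Rips}(X)_r$ (of $\check{\mathrm C}\mathrm{ech}(X)_r$). These are filtrations over $\mathbb Z^{\mathrm{op}}\times\mathbb R_{\ge0}$; $\mathrm{dgm}_1$ of a filtration denotes the GPD of its simplicial homology $\mathrm H_1(-;\mathbb F)$. **Theorem (Super-polynomial GPD of Degree-Rips and Degree-Čech filtrations).** 1. There is no $k\in\mathbb Z_{\ge0}$ such that $\|\mathrm{dgm}_1(\mathrm{DRips}(X))\|=O(|X|^k)$ over all finite metric spaces $X$. 2. There is no $k\in\mathbb Z_{\ge0}$ such that $\|\mathrm{dgm}_1(\mathrm{D}\check{\mathrm C}\mathrm{ech}(X))\|=O(|X|^k)$ over all finite subsets $X$ of $\mathbb R^3$ with the supremum metric (hence none over any larger class of finite metric spaces in Euclidean spaces). 3. Explicit witnesses: let $n\ge 2$,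 $\epsilon=1/n^2$, $b_j=n+(j-n)\epsilon$ for $0\le j\le n+1$, $a=b_0$, $A=\{(1,0),(0,1),(-1,0),(0,-1)\}$, $B=\{(1,\epsilon),(-\epsilon,1),(-1,-\epsilon),(\epsilon,-1)\}$, and let $$X_n=\bigcup_{i=0}^n\Big(aA\ \cup\bigcup_{0\le j\le n,\ j\ne i}(a+b_j)A\ \cup\ (a+b_{i+1})B\Big)\times\{(n+\epsilon)i\}\subset\mathbb R^3$$ with the supremum metric. Then $|X_n|=4(n+1)(n+2)$. Let $M$ be $\mathrm H_1(\mathrm{DRips}(X_n);\mathbb F)$ and $c=1$, or let $M$ be $\mathrm H_1(\mathrm{D}\check{\mathrm C}\mathrm{ech}(X_n);\mathbb F)$ and $c=1/2$. The pullback $M'$ of $M$ to $\{0,\dots,n+1\}^2$ along $(i,j)\mapsto(n+4-i,\ c\,b_j)$ is isomorphic to the following module. For $j\le n$, its value at $(i,j)$ is $0$ if $i+j<n$, the hyperplane $\{v\in\mathbb F^{n+1}:v_i=0\}\cong\mathbb F^n$ if $i+j=n$, and $\mathbb F^{n+1}$ if $i+j>n$ (coordinates $v_0,\dots,v_n$),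 with inclusions as maps. For $j=n+1$, its value is $\mathbb F$ and the maps within this row are identities. The maps from $j\le n$ to $j=n+1$ are $v\mapsto v_0+\dots+v_n$. Moreover, the GPD of $M$ exists and has finite support, $\|\mathrm{dgm}_{M'}\|\ge 2^{n+1}-1$, and $\|\mathrm{dgm}_M\|\ge 2^{n+1}-1$. -/

import Mathlib

open scoped NNReal

set_option maxSynthPendingDepth 3

/-! ### Intervals of a poset, persistence modules, generalized rank invariant and diagram -/

/-- An interval of a poset: a nonempty, convex subset, any two elements of which are joined by a
finite sequence of consecutively comparable elements of the subset. -/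
structure IsPosetInterval {P : Type*} [PartialOrder P] (I : Set P) : Prop where
  nonempty : I.Nonempty
  convex : ∀ p ∈ I, ∀ q ∈ I, ∀ r, p ≤ r → r ≤ q → r ∈ I
  connected : ∀ p ∈ I, ∀ q ∈ I,
    Relation.ReflTransGen (fun a b => b ∈ I ∧ (a ≤ b ∨ b ≤ a)) p q

/-- The set of all intervals of a poset. -/
abbrev PosetInt (P : Type*) [PartialOrder P] : Type _ := {I : Set P // IsPosetInterval I}

section PersistenceModules

universe w u v

/-- A persistence module over the poset `P`: a functor from `P` (as a category) to
finite-dimensional vector spaces over `F`. -/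
structure PersistenceModule (F : Type u) [Field F] (P : Type v) [PartialOrder P] where
  obj : P → Type w
  [addCommGroup : ∀ p, AddCommGroup (obj p)]
  [module : ∀ p, Module F (obj p)]
  [finiteDimensional : ∀ p, FiniteDimensional F (obj p)]
  map : ∀ {p q : P}, p ≤ q → obj p →ₗ[F] obj q
  map_id : ∀ (p : P) (x : obj p), map (le_refl p) x = x
  map_comp : ∀ {p q r : P} (h : p ≤ q) (h' : q ≤ r) (x : obj p),
    map (h.trans h') x = map h' (map h x)

attribute [instance] PersistenceModule.addCommGroup PersistenceModule.module
  PersistenceModule.finiteDimensional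

/-- The limit of the restriction of `M` to a subset `I`: the space of sections over `I`. -/
def pmLimit {F : Type u} [Field F] {P : Type v} [PartialOrder P] (M : PersistenceModule.{w} F P)
    (I : Set P) : Submodule F (∀ p : I, M.obj p.1) where
  carrier := {l | ∀ (p q : I) (h : p.1 ≤ q.1), M.map h (l p) = l q}
  add_mem' := by
    intro a b ha hb p q h
    simp [ha p q h, hb p q h]
  zero_mem' := by
    intro p q h
    simp
  smul_mem' := by
    intro c a ha p q h
    simp [ha p q h]

/-- The projection from the limit of `M` restricted to `I` to the value at a point of `I`. -/
def pmLimitProj {F : Type u} [Field F] {P : Type v} [PartialOrder P] (M : PersistenceModule.{w} F P)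
    (I : Set P) (p : I) : pmLimit M I →ₗ[F] M.obj p.1 :=
  (LinearMap.proj p).comp (pmLimit M I).subtype

open Classical in
/-- The colimit of the restriction of `M` to a subset `I` (Mathlib's `Module.DirectLimit` is the
colimit over an arbitrary preorder, directed or not). -/
def PmColimit {F : Type u} [Field F] {P : Type v} [PartialOrder P] (M : PersistenceModule.{w} F P)
    (I : Set P) : Type _ :=
  Module.DirectLimit (fun p : I => M.obj p.1) (fun p q h => M.map (show p.1 ≤ q.1 from h))

open Classical in
noncomputable instance {F : Type u} [Field F] {P : Type v} [PartialOrder P]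
    (M : PersistenceModule.{w} F P) (I : Set P) : AddCommGroup (PmColimit M I) :=
  Module.DirectLimit.addCommGroup (fun p : I => M.obj p.1)
    (fun p q h => M.map (show p.1 ≤ q.1 from h))

open Classical in
noncomputable instance {F : Type u} [Field F] {P : Type v} [PartialOrder P]
    (M : PersistenceModule.{w} F P) (I : Set P) : Module F (PmColimit M I) :=
  Module.DirectLimit.module (fun p : I => M.obj p.1)
    (fun p q h => M.map (show p.1 ≤ q.1 from h))

open Classical in
/-- The inclusion of the value at a point of `I` into the colimit of `M` restricted to `I`. -/
noncomputable def pmColimitIncl {F : Type u} [Field F] {P : Type v} [PartialOrder P]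
    (M : PersistenceModule.{w} F P) (I : Set P) (p : I) : M.obj p.1 →ₗ[F] PmColimit M I :=
  Module.DirectLimit.of F I (fun p : I => M.obj p.1)
    (fun p q h => M.map (show p.1 ≤ q.1 from h)) p

theorem pmColimitIncl_map {F : Type u} [Field F] {P : Type v} [PartialOrder P]
    (M : PersistenceModule.{w} F P) (I : Set P) {a b : I} (h : a.1 ≤ b.1) (x : M.obj a.1) :
    pmColimitIncl M I b (M.map h x) = pmColimitIncl M I a x := by
  classical
  exact Module.DirectLimit.of_f (G := fun p : I => M.obj p.1)
    (f := fun p q h => M.map (show p.1 ≤ q.1 from h)) (hij := h)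

/-- The limit-to-colimit map through the point `p` of the interval `I`. -/
noncomputable def pmLimToColim {F : Type u} [Field F] {P : Type v} [PartialOrder P]
    (M : PersistenceModule.{w} F P) (I : Set P) (p : I) : pmLimit M I →ₗ[F] PmColimit M I :=
  (pmColimitIncl M I p).comp (pmLimitProj M I p)

/-- The limit-to-colimit map over an interval does not depend on the point. -/
theorem pmLimToColim_eq {F : Type u} [Field F] {P : Type v} [PartialOrder P]
    (M : PersistenceModule.{w} F P) (I : PosetInt P) (p q : I.1) :
    pmLimToColim M I.1 p = pmLimToColim M I.1 q := by
  have step : ∀ a b : I.1, a.1 ≤ b.1 → pmLimToColim M I.1 a = pmLimToColim M I.1 b := by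
    intro a b h
    ext l
    have h1 : pmLimitProj M I.1 b l = M.map h (pmLimitProj M I.1 a l) := (l.2 a b h).symm
    simp only [pmLimToColim, LinearMap.comp_apply, h1]
    exact (pmColimitIncl_map M I.1 h _).symm
  have key : ∀ y : P, Relation.ReflTransGen (fun a b => b ∈ I.1 ∧ (a ≤ b ∨ b ≤ a)) p.1 y →
      ∃ hy : y ∈ I.1, pmLimToColim M I.1 p = pmLimToColim M I.1 ⟨y, hy⟩ := by
    intro y hy
    induction hy with
    | refl => exact ⟨p.2, rfl⟩
    | tail _ hbc ih =>
      obtain ⟨hb, e⟩ := ih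
      refine ⟨hbc.1, e.trans ?_⟩
      rcases hbc.2 with h | h
      · exact step _ _ h
      · exact (step _ _ h).symm
  obtain ⟨_, e⟩ := key q.1 (I.2.connected p.1 p.2 q.1 q.2)
  exact e

/-- The generalized rank invariant: the rank of the canonical limit-to-colimit map of the
restriction of `M` to the interval `I`. -/
noncomputable def genRank {F : Type u} [Field F] {P : Type v} [PartialOrder P]
    (M : PersistenceModule.{w} F P) (I : PosetInt P) : ℕ :=
  Module.finrank F (LinearMap.range
    (pmLimToColim M I.1 ⟨I.2.nonempty.some, I.2.nonempty.some_mem⟩))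

/-- `f` is a generalized persistence diagram of `M`: for every interval `I`, the sum of `f` over
the intervals `J ⊇ I` has only finitely many nonzero summands and equals the rank over `I`. -/
def IsGPD {F : Type u} [Field F] {P : Type v} [PartialOrder P] (M : PersistenceModule.{w} F P)
    (f : PosetInt P → ℤ) : Prop :=
  ∀ I : PosetInt P, {J : PosetInt P | I.1 ⊆ J.1 ∧ f J ≠ 0}.Finite ∧
    (genRank M I : ℤ) = ∑ᶠ (J : PosetInt P) (_ : I.1 ⊆ J.1), f J

/-- A persistence module has at most one generalized persistence diagram. -/
theorem IsGPD.unique {F : Type u} [Field F] {P : Type v} [PartialOrder P]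
    {M : PersistenceModule.{w} F P} {f g : PosetInt P → ℤ} (hf : IsGPD M f) (hg : IsGPD M g) :
    f = g := by
  by_contra hne
  obtain ⟨I, hI⟩ := Function.ne_iff.mp hne
  have hfin : {J : PosetInt P | I.1 ⊆ J.1 ∧ f J ≠ g J}.Finite := by
    refine ((hf I).1.union (hg I).1).subset ?_
    rintro J ⟨h1, h2⟩
    by_cases h : f J = 0
    · exact Or.inr ⟨h1, fun h' => h2 (h.trans h'.symm)⟩
    · exact Or.inl ⟨h1, h⟩
  obtain ⟨K, hK⟩ := hfin.exists_maximal ⟨I, subset_rfl, hI⟩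
  have hKI := hK.prop
  have hKmax : ∀ J : PosetInt P, K.1 ⊆ J.1 → J ≠ K → f J = g J := by
    intro J h1 h2
    by_contra h3
    exact h2 (le_antisymm (hK.le_of_ge (y := J) ⟨hKI.1.trans h1, h3⟩ h1) h1)
  have e : ∑ᶠ (J : PosetInt P) (_ : K.1 ⊆ J.1), f J
      = ∑ᶠ (J : PosetInt P) (_ : K.1 ⊆ J.1), g J := (hf K).2.symm.trans (hg K).2
  have expand : ∀ h : PosetInt P → ℤ, {J : PosetInt P | K.1 ⊆ J.1 ∧ h J ≠ 0}.Finite →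
      ∑ᶠ (J : PosetInt P) (_ : K.1 ⊆ J.1), h J
        = h K + ∑ᶠ (J : PosetInt P) (_ : K.1 ⊆ J.1 ∧ J ≠ K), h J := by
    intro h hh
    have hs : {J : PosetInt P | K.1 ⊆ J.1} = insert K {J : PosetInt P | K.1 ⊆ J.1 ∧ J ≠ K} := by
      ext J
      by_cases hJ : J = K
      · simp [hJ]
      · simp [hJ]
    have := finsum_mem_insert' (f := h) (a := K) (s := {J : PosetInt P | K.1 ⊆ J.1 ∧ J ≠ K})
      (by simp) (hh.subset (fun J hJ => ⟨hJ.1.1, hJ.2⟩))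
    rw [← hs] at this
    exact this
  rw [expand f (hf K).1, expand g (hg K).1] at e
  have e2 : ∑ᶠ (J : PosetInt P) (_ : K.1 ⊆ J.1 ∧ J ≠ K), f J
      = ∑ᶠ (J : PosetInt P) (_ : K.1 ⊆ J.1 ∧ J ≠ K), g J :=
    finsum_congr fun J => finsum_congr fun hJ => hKmax J hJ.1 hJ.2
  rw [e2] at e
  exact hKI.2 (add_right_cancel e)

open Classical in
/-- The generalized persistence diagram of `M` (zero if it does not exist). -/
noncomputable def gpd {F : Type u} [Field F] {P : Type v} [PartialOrder P]
    (M : PersistenceModule.{w} F P) : PosetInt P → ℤ :=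
  if h : ∃ f, IsGPD M f then h.choose else 0

/-- The size of the generalized persistence diagram: the cardinality of its support. If the
diagram does not exist or its support is infinite this is `0`, so that a positive lower bound on
the size includes the existence of the diagram and the finiteness of its support. -/
noncomputable def gpdSize {F : Type u} [Field F] {P : Type v} [PartialOrder P]
    (M : PersistenceModule.{w} F P) : ℕ :=
  (Function.support (gpd M)).ncard

end PersistenceModules

/-! ### Simplicial homology of abstract simplicial complexes -/

section Homology

universe u v

/-- The tuple `s` of vertices spans a simplex of `K` (repetitions are allowed). -/
def SpansSimplex {V : Type v} (K : PreAbstractSimplicialComplex V) {m : ℕ} (s : Fin m → V) :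
    Prop :=
  ∃ σ ∈ K, (σ : Set V) = Set.range s

/-- Formal linear combinations of tuples of `m + 1` vertices that span simplices of `K`. -/
noncomputable def tupleChains (F : Type u) [Field F] {V : Type v} (K : PreAbstractSimplicialComplex V) (m : ℕ) :
    Submodule F ((Fin (m + 1) → V) →₀ F) :=
  Finsupp.supported F F {s | SpansSimplex K s}

/-- The orientation relations in degree `m`: a tuple with a repeated vertex is zero, and permuting
the vertices of a tuple multiplies it by the sign of the permutation. The quotient
`tupleChains F K m ⧸ orientationRel F K m` is the space of oriented simplicial `m`-chains. -/
noncomputable def orientationRel (F : Type u) [Field F] {V : Type v} (K : PreAbstractSimplicialComplex V)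
    (m : ℕ) : Submodule F ((Fin (m + 1) → V) →₀ F) :=
  Submodule.span F
    ({x | ∃ s : Fin (m + 1) → V, SpansSimplex K s ∧ ¬ Function.Injective s ∧
        x = Finsupp.single s 1} ∪
      {x | ∃ (s : Fin (m + 1) → V) (π : Equiv.Perm (Fin (m + 1))), SpansSimplex K s ∧
        x = Finsupp.single (s ∘ π) 1 - ((Equiv.Perm.sign π : ℤ) : F) • Finsupp.single s 1})

/-- The boundary operator from degree `m + 1` to degree `m`,
`[v₀, …, vₘ₊₁] ↦ ∑ i, (-1) ^ i [v₀, …, v̂ᵢ, …, vₘ₊₁]`. -/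
noncomputable def simplicialBoundary (F : Type u) [Field F] (V : Type v) (m : ℕ) :
    ((Fin (m + 1 + 1) → V) →₀ F) →ₗ[F] ((Fin (m + 1) → V) →₀ F) :=
  ∑ i : Fin (m + 1 + 1), (-1 : F) ^ (i : ℕ) •
    Finsupp.lmapDomain F F (fun s : Fin (m + 1 + 1) → V => s ∘ i.succAbove)

/-- Representatives of `m`-cycles: chains of `K` whose boundary is zero as an oriented chain. -/
noncomputable def simplicialCycles (F : Type u) [Field F] {V : Type v} (K : PreAbstractSimplicialComplex V) :
    (m : ℕ) → Submodule F ((Fin (m + 1) → V) →₀ F)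
  | 0 => tupleChains F K 0
  | m + 1 => tupleChains F K (m + 1) ⊓ (orientationRel F K m).comap (simplicialBoundary F V m)

/-- Representatives of `m`-boundaries: boundaries of `(m + 1)`-chains of `K`, up to the
orientation relations. -/
noncomputable def simplicialBoundaries (F : Type u) [Field F] {V : Type v}
    (K : PreAbstractSimplicialComplex V) (m : ℕ) : Submodule F ((Fin (m + 1) → V) →₀ F) :=
  (tupleChains F K (m + 1)).map (simplicialBoundary F V m) ⊔ orientationRel F K m

/-- The simplicial homology `H_m(K; F)`: cycles modulo boundaries in the oriented chain complex. -/
abbrev SimplicialHomology (F : Type u) [Field F] {V : Type v} (K : PreAbstractSimplicialComplex V)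
    (m : ℕ) : Type (max u v) :=
  simplicialCycles F K m ⧸ (simplicialBoundaries F K m).submoduleOf (simplicialCycles F K m)

theorem SpansSimplex.mono {V : Type v} {K L : PreAbstractSimplicialComplex V} (h : K ≤ L) {m : ℕ}
    {s : Fin m → V} (hs : SpansSimplex K s) : SpansSimplex L s := by
  obtain ⟨σ, hσ, e⟩ := hs
  exact ⟨σ, h hσ, e⟩

theorem tupleChains_mono (F : Type u) [Field F] {V : Type v}
    {K L : PreAbstractSimplicialComplex V} (h : K ≤ L) (m : ℕ) :
    tupleChains F K m ≤ tupleChains F L m :=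
  Finsupp.supported_mono fun _ hs => SpansSimplex.mono h hs

theorem orientationRel_mono (F : Type u) [Field F] {V : Type v}
    {K L : PreAbstractSimplicialComplex V} (h : K ≤ L) (m : ℕ) :
    orientationRel F K m ≤ orientationRel F L m := by
  refine Submodule.span_mono (Set.union_subset_union ?_ ?_)
  · rintro x ⟨s, hs, hx⟩
    exact ⟨s, hs.mono h, hx⟩
  · rintro x ⟨s, π, hs, hx⟩
    exact ⟨s, π, hs.mono h, hx⟩

theorem simplicialCycles_mono (F : Type u) [Field F] {V : Type v}
    {K L : PreAbstractSimplicialComplex V} (h : K ≤ L) (m : ℕ) :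
    simplicialCycles F K m ≤ simplicialCycles F L m := by
  cases m with
  | zero => exact tupleChains_mono F h 0
  | succ m =>
    exact inf_le_inf (tupleChains_mono F h _) (Submodule.comap_mono (orientationRel_mono F h m))

theorem simplicialBoundaries_mono (F : Type u) [Field F] {V : Type v}
    {K L : PreAbstractSimplicialComplex V} (h : K ≤ L) (m : ℕ) :
    simplicialBoundaries F K m ≤ simplicialBoundaries F L m :=
  sup_le_sup (Submodule.map_mono (tupleChains_mono F h _)) (orientationRel_mono F h m)

/-- The map in homology induced by the inclusion of a subcomplex. -/
noncomputable def simplicialHomologyMap (F : Type u) [Field F] {V : Type v}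
    {K L : PreAbstractSimplicialComplex V} (h : K ≤ L) (m : ℕ) :
    SimplicialHomology F K m →ₗ[F] SimplicialHomology F L m :=
  Submodule.mapQ _ _ (Submodule.inclusion (simplicialCycles_mono F h m))
    (fun _ hx => simplicialBoundaries_mono F h m hx)

/-- The persistence module `H_m(𝓕; F)` of a simplicial filtration `𝓕` on a finite vertex set,
indexed by a poset. -/
noncomputable def filtrationHomology (F : Type u) [Field F] {V : Type v} [Finite V] {P : Type*}
    [PartialOrder P] (𝓕 : P →o PreAbstractSimplicialComplex V) (m : ℕ) :
    PersistenceModule.{max u v} F P where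
  obj p := SimplicialHomology F (𝓕 p) m
  map h := simplicialHomologyMap F (𝓕.monotone h) m
  map_id p x := by
    obtain ⟨x, rfl⟩ := Submodule.Quotient.mk_surjective _ x
    rfl
  map_comp h h' x := by
    obtain ⟨x, rfl⟩ := Submodule.Quotient.mk_surjective _ x
    rfl

end Homology

/-! ### Degree-Rips and degree-Čech bifiltrations -/

/-- The Vietoris–Rips filtration of a metric space: at scale `r`, the nonempty finite sets of
points at pairwise distance at most `r`. -/
def ripsFiltration (X : Type*) [MetricSpace X] : ℝ≥0 →o PreAbstractSimplicialComplex X where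
  toFun r :=
    { faces := {σ | σ.Nonempty ∧ ∀ x ∈ σ, ∀ y ∈ σ, dist x y ≤ r}
      isRelLowerSet_faces := fun {_} hσ =>
        ⟨hσ.1, fun _ hτσ hτ => ⟨hτ, fun x hx y hy => hσ.2 x (hτσ hx) y (hτσ hy)⟩⟩ }
  monotone' := fun _ _ hrs _ hσ =>
    ⟨hσ.1, fun x hx y hy => (hσ.2 x hx y hy).trans (NNReal.coe_le_coe.mpr hrs)⟩

/-- The Čech filtration of a finite subset `X` of a metric space `E`: at scale `r`, the nonempty
sets of points of `X` whose closed `r`-balls in `E` have a common point. -/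
def cechFiltration {E : Type*} [MetricSpace E] (X : Finset E) :
    ℝ≥0 →o PreAbstractSimplicialComplex X where
  toFun r :=
    { faces := {σ | σ.Nonempty ∧ (⋂ x ∈ σ, Metric.closedBall (x : E) r).Nonempty}
      isRelLowerSet_faces := fun {_} hσ =>
        ⟨hσ.1, fun _ hτσ hτ => ⟨hτ, hσ.2.mono (Set.biInter_subset_biInter_left hτσ)⟩⟩ }
  monotone' := fun _ _ hrs _ hσ =>
    ⟨hσ.1, hσ.2.mono (Set.iInter₂_mono fun _ _ =>
      Metric.closedBall_subset_closedBall (NNReal.coe_le_coe.mpr hrs))⟩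

/-- The neighbours of the vertex `x` in the 1-skeleton of `K`. -/
def complexNeighbors {V : Type*} (K : PreAbstractSimplicialComplex V) (x : V) : Set V :=
  {y | y ≠ x ∧ ∃ σ ∈ K, (σ : Set V) = {x, y}}

/-- The degree bifiltration of a filtration `K` by complexes on a finite set: at degree `d` and
scale `r`, the maximal subcomplex of `K r` whose vertices have degree at least `d - 1` in the
1-skeleton of `K r`. It is indexed by `ℤᵒᵖ × ℝ≥0` (larger degrees come first). -/
def degreeBifiltration {V : Type*} [Finite V] (K : ℝ≥0 →o PreAbstractSimplicialComplex V) :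
    ℤᵒᵈ × ℝ≥0 →o PreAbstractSimplicialComplex V where
  toFun p :=
    { faces := {σ | σ ∈ K p.2 ∧
        ∀ x ∈ σ, OrderDual.ofDual p.1 - 1 ≤ ((complexNeighbors (K p.2) x).ncard : ℤ)}
      isRelLowerSet_faces := fun {_} hσ =>
        ⟨((K p.2).isRelLowerSet_faces hσ.1).1, fun _ hτσ hτ =>
          ⟨((K p.2).isRelLowerSet_faces hσ.1).2 hτσ hτ, fun x hx => hσ.2 x (hτσ hx)⟩⟩ }
  monotone' := by
    rintro ⟨d, r⟩ ⟨e, s⟩ ⟨hde, hrs⟩ σ hσ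
    refine ⟨K.monotone hrs hσ.1, fun x hx => ?_⟩
    have h1 : OrderDual.ofDual e ≤ OrderDual.ofDual d := hde
    have h2 : (complexNeighbors (K r) x).ncard ≤ (complexNeighbors (K s) x).ncard := by
      refine Set.ncard_le_ncard ?_ (Set.toFinite _)
      rintro y ⟨hy, τ, hτ, e⟩
      exact ⟨hy, τ, K.monotone hrs hτ, e⟩
    have h3 : OrderDual.ofDual d - 1 ≤ ((complexNeighbors (K r) x).ncard : ℤ) := hσ.2 x hx
    have h4 : ((complexNeighbors (K r) x).ncard : ℤ) ≤ (complexNeighbors (K s) x).ncard := by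
      exact_mod_cast h2
    show OrderDual.ofDual e - 1 ≤ ((complexNeighbors (K s) x).ncard : ℤ)
    linarith

/-- The degree-Rips bifiltration of a finite metric space. -/
def degreeRips (X : Type*) [MetricSpace X] [Finite X] :
    ℤᵒᵈ × ℝ≥0 →o PreAbstractSimplicialComplex X :=
  degreeBifiltration (ripsFiltration X)

/-- The degree-Čech bifiltration of a finite subset of a metric space. -/
def degreeCech {E : Type*} [MetricSpace E] (X : Finset E) :
    ℤᵒᵈ × ℝ≥0 →o PreAbstractSimplicialComplex X :=
  degreeBifiltration (cechFiltration X)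

/-! ### The explicit point sets

`Fin 3 → ℝ` carries the supremum metric. -/

/-- `b_j = n + (j - n) / n²`. -/
noncomputable def scaleB (n j : ℕ) : ℝ := n + ((j : ℝ) - n) * (1 / (n : ℝ) ^ 2)

/-- The point of `ℝ³` with horizontal part `t • u` and height `z`. -/
def spacePoint (t : ℝ) (u : ℝ × ℝ) (z : ℝ) : Fin 3 → ℝ := ![t * u.1, t * u.2, z]

/-- The four axis directions. -/
def dirA : Fin 4 → ℝ × ℝ := ![(1, 0), (0, 1), (-1, 0), (0, -1)]

/-- The four slightly rotated axis directions. -/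
def dirB (ε : ℝ) : Fin 4 → ℝ × ℝ := ![(1, ε), (-ε, 1), (-1, -ε), (ε, -1)]

/-- The point set `X_n`: with `ε = 1 / n²` and `a = b_0 = n - n ε`, its layer at height
`(n + ε) i`, for `0 ≤ i ≤ n`, has horizontal part
`a A ∪ ⋃_{0 ≤ j ≤ n, j ≠ i} (a + b_j) A ∪ (a + b_{i+1}) B`. -/
noncomputable def witnessSet (n : ℕ) : Finset (Fin 3 → ℝ) :=
  (Finset.range (n + 1)).biUnion fun i =>
    let ε : ℝ := 1 / (n : ℝ) ^ 2
    let z : ℝ := (n + ε) * i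
    let a : ℝ := scaleB n 0
    (Finset.univ.image fun q => spacePoint a (dirA q) z) ∪
      (((Finset.range (n + 1)).erase i).biUnion fun j =>
        Finset.univ.image fun q => spacePoint (a + scaleB n j) (dirA q) z) ∪
      (Finset.univ.image fun q => spacePoint (a + scaleB n (i + 1)) (dirB ε q) z)

/-! ### The subgrid and the zigzag structure -/

/-- The subgrid of `ℤᵒᵖ × ℝ≥0` given by the degrees `n + 4 < n + 3 < ⋯ < 3` (in `ℤᵒᵖ`) and the
scales `c b_0 < c b_1 < ⋯ < c b_{n+1}`: the point `(i, j)` goes to `(n + 4 - i, c b_j)`. -/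
noncomputable def subgrid (n : ℕ) (c : ℝ≥0) : Fin (n + 2) × Fin (n + 2) →o ℤᵒᵈ × ℝ≥0 where
  toFun p := (OrderDual.toDual ((n : ℤ) + 4 - (p.1 : ℕ)), c * (scaleB n p.2).toNNReal)
  monotone' := by
    rintro ⟨i, j⟩ ⟨i', j'⟩ ⟨hi, hj⟩
    refine ⟨?_, ?_⟩
    · have h : (i : ℕ) ≤ (i' : ℕ) := hi
      show ((n : ℤ) + 4 - (i' : ℕ)) ≤ ((n : ℤ) + 4 - (i : ℕ))
      have h' : ((i : ℕ) : ℤ) ≤ ((i' : ℕ) : ℤ) := by exact_mod_cast h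
      linarith
    · have h : (j : ℕ) ≤ (j' : ℕ) := hj
      have h' : ((j : ℕ) : ℝ) ≤ ((j' : ℕ) : ℝ) := by exact_mod_cast h
      refine mul_le_mul_right (Real.toNNReal_le_toNNReal ?_) _
      unfold scaleB
      have : (0 : ℝ) ≤ 1 / (n : ℝ) ^ 2 := by positivity
      nlinarith [mul_le_mul_of_nonneg_right h' this]

/-- The restriction of a persistence module along a monotone map of posets. -/
def PersistenceModule.restrict {F : Type*} [Field F] {P Q : Type*} [PartialOrder P]
    [PartialOrder Q] (M : PersistenceModule F Q) (g : P →o Q) : PersistenceModule F P where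
  obj p := M.obj (g p)
  map h := M.map (g.monotone h)
  map_id p x := M.map_id (g p) x
  map_comp h h' x := M.map_comp (g.monotone h) (g.monotone h') x

/-- `N` is isomorphic to the following module over `{0, …, n+1}²`. In the rows `j ≤ n` its value
at `(i, j)` is `0` if `i + j < n`, the hyperplane `{v : v_i = 0}` of `F^{n+1}` (that is, the image
of the `i`-th coordinate inclusion of `F^n`) if `i + j = n`, and `F^{n+1}` if `i + j > n`, and the
maps between these rows are the inclusions. In the row `j = n + 1` its value is `F` and the maps
are identities, and the maps into that row send `v` to `v_0 + ⋯ + v_n`. -/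
def HasZigzagStructure {F : Type*} [Field F] (n : ℕ)
    (N : PersistenceModule F (Fin (n + 2) × Fin (n + 2))) : Prop :=
  ∃ (φ : ∀ p, N.obj p →ₗ[F] (Fin (n + 1) → F)) (ψ : ∀ p, N.obj p →ₗ[F] F),
    (∀ p : Fin (n + 2) × Fin (n + 2), (p.2 : ℕ) ≤ n →
      Function.Injective (φ p) ∧
      ∀ v : Fin (n + 1) → F, v ∈ LinearMap.range (φ p) ↔
        ((p.1 : ℕ) + p.2 < n → v = 0) ∧
        ((p.1 : ℕ) + p.2 = n → ∀ k : Fin (n + 1), (k : ℕ) = p.1 → v k = 0)) ∧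
    (∀ p : Fin (n + 2) × Fin (n + 2), (p.2 : ℕ) = n + 1 → Function.Bijective (ψ p)) ∧
    (∀ (p q : Fin (n + 2) × Fin (n + 2)) (h : p ≤ q), (q.2 : ℕ) ≤ n →
      ∀ x, φ q (N.map h x) = φ p x) ∧
    (∀ (p q : Fin (n + 2) × Fin (n + 2)) (h : p ≤ q), (p.2 : ℕ) ≤ n → (q.2 : ℕ) = n + 1 →
      ∀ x, ψ q (N.map h x) = ∑ k, φ p x k) ∧
    (∀ (p q : Fin (n + 2) × Fin (n + 2)) (h : p ≤ q), (p.2 : ℕ) = n + 1 →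
      ∀ x, ψ q (N.map h x) = ψ p x)

/-!
Layer `i` of the witness is a square of four points, which spans a `4`-cycle at all scales in
question, with a cluster of `n + 1` points around each vertex. The points of a cluster become
adjacent to their vertex at the scales `b_j`, one at a time, but the one due at scale `b_i` comes
only at scale `b_{i+1}`, so the vertices have a degree one too small precisely at scale `b_i`. Hence
at the grid point `(n - i, i)` all layers but layer `i` are present. As the clusters are dominated
by the vertices and the layers meet only at scale `b_{n+1}`, where all the squares become homotopic,
the first homology is the module of coordinate hyperplanes with the sum of coordinates as last map.

For a set `U` of coordinates, the generalized rank over the interval from the hyperplanes with index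
outside `U` to the last row is the rank of the sum of coordinates on the vectors supported in `U`:
it is `0` for `U = ∅` and `1` otherwise. Möbius inversion over `U` turns these ranks into `± 1` for
every `U ≠ ∅`, and these numbers are sums of values of the diagram over disjoint sets of intervals,
so its support has at least `2 ^ (n + 1) - 1` elements.

A diagram exists because a filtration of a finite complex over `ℤᵒᵖ × ℝ≥0` is pulled back from a
finite grid, which leaves only finitely many intervals to distinguish.
-/

/-! ### Intervals in a product of two chains -/

section ProductIntervals

/-- A step inside `I` which goes up, or goes down within a fibre of `ρ`. The sections of a pullback
along `ρ` over `I` can be transported along such steps. -/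
def FiberStep {P Q : Type*} [PartialOrder P] [PartialOrder Q] (ρ : P →o Q) (I : Set P)
    (p q : P) : Prop :=
  p ∈ I ∧ q ∈ I ∧ (p ≤ q ∨ (q ≤ p ∧ ρ p = ρ q))

theorem FiberStep.mono {P Q : Type*} [PartialOrder P] [PartialOrder Q] {ρ : P →o Q} {I J : Set P}
    (hIJ : I ⊆ J) {p q : P} (h : FiberStep ρ I p q) : FiberStep ρ J p q :=
  ⟨hIJ h.1, hIJ h.2.1, h.2.2⟩

variable {α β A B : Type*} [LinearOrder α] [LinearOrder β] [PartialOrder A] [PartialOrder B]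

theorem FiberStep.of_fst_eq {ρ₁ : α →o A} {ρ₂ : β →o B} {I : Set (α × β)} {p q : α × β}
    (hp : p ∈ I) (hq : q ∈ I) (h₁ : p.1 = q.1) (h₂ : ρ₂ p.2 = ρ₂ q.2) :
    FiberStep (ρ₁.prodMap ρ₂) I p q := by
  refine ⟨hp, hq, ?_⟩
  rcases le_total p.2 q.2 with h | h
  · exact .inl ⟨h₁.le, h⟩
  · exact .inr ⟨⟨h₁.ge, h⟩, Prod.ext (congrArg ρ₁ h₁) h₂⟩

/-- The nearest-point projection onto the rectangle with upper left corner `p` and lower right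
corner `q`. -/
def clampToRectangle (p q x : α × β) : α × β :=
  (max p.1 (min x.1 q.1), max q.2 (min x.2 p.2))

theorem clampToRectangle_mono (p q : α × β) : Monotone (clampToRectangle p q) := fun _ _ h =>
  ⟨max_le_max le_rfl (min_le_min h.1 le_rfl), max_le_max le_rfl (min_le_min h.2 le_rfl)⟩

theorem clampToRectangle_mem {p q : α × β} (h₁ : p.1 ≤ q.1) (h₂ : q.2 ≤ p.2) (x : α × β) :
    clampToRectangle p q x ∈ Set.Icc p.1 q.1 ×ˢ Set.Icc q.2 p.2 :=
  ⟨⟨le_max_left _ _, max_le h₁ (min_le_right _ _)⟩, ⟨le_max_left _ _, max_le h₂ (min_le_right _ _)⟩⟩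

theorem clampToRectangle_eq_self {p q x : α × β}
    (hx : x ∈ Set.Icc p.1 q.1 ×ˢ Set.Icc q.2 p.2) : clampToRectangle p q x = x := by
  obtain ⟨⟨h₁, h₂⟩, h₃, h₄⟩ := hx
  exact Prod.ext (by rw [clampToRectangle, min_eq_left h₂, max_eq_right h₁])
    (by rw [clampToRectangle, min_eq_left h₄, max_eq_right h₃])

namespace IsPosetInterval

variable {I : Set (α × β)} {p q r : α × β}

theorem preimage_swap (hI : IsPosetInterval I) : IsPosetInterval (Prod.swap ⁻¹' I) where
  nonempty := hI.nonempty.preimage Prod.swap_surjective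
  convex _ hp _ hq r hpr hrq :=
    hI.convex _ hp _ hq r.swap (Prod.swap_le_swap.mpr hpr) (Prod.swap_le_swap.mpr hrq)
  connected p hp q hq :=
    (hI.connected p.swap hp q.swap hq).lift Prod.swap fun _ _ h =>
      ⟨h.1, h.2.imp Prod.swap_le_swap.mpr Prod.swap_le_swap.mpr⟩

theorem clampToRectangle_mem (hI : IsPosetInterval I) (hp : p ∈ I) (hq : q ∈ I) (h₁ : p.1 ≤ q.1)
    (h₂ : q.2 ≤ p.2) (hr : r ∈ I) : clampToRectangle p q r ∈ I := by
  have hmem := _root_.clampToRectangle_mem h₁ h₂ r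
  have hlower : ∃ l ∈ I, l ≤ clampToRectangle p q r := by
    rcases le_total q.1 r.1 with h | h
    · exact ⟨q, hq, le_max_of_le_right (min_eq_right h).ge, hmem.2.1⟩
    rcases le_total p.2 r.2 with h' | h'
    · exact ⟨p, hp, hmem.1.1, le_max_of_le_right (min_eq_right h').ge⟩
    · exact ⟨r, hr, le_max_of_le_right (min_eq_left h).ge, le_max_of_le_right (min_eq_left h').ge⟩
  have hupper : ∃ u ∈ I, clampToRectangle p q r ≤ u := by
    rcases le_total r.1 p.1 with h | h
    · exact ⟨p, hp, max_le le_rfl ((min_le_left _ _).trans h), hmem.2.2⟩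
    rcases le_total r.2 q.2 with h' | h'
    · exact ⟨q, hq, hmem.1.2, max_le le_rfl ((min_le_left _ _).trans h')⟩
    · exact ⟨r, hr, max_le h (min_le_left _ _), max_le h' (min_le_left _ _)⟩
  obtain ⟨l, hl, hlr⟩ := hlower
  obtain ⟨u, hu, hru⟩ := hupper
  exact hI.convex l hl u hu _ hlr hru

theorem inter_rectangle (hI : IsPosetInterval I) (hp : p ∈ I) (hq : q ∈ I) (h₁ : p.1 ≤ q.1)
    (h₂ : q.2 ≤ p.2) : IsPosetInterval (I ∩ Set.Icc p.1 q.1 ×ˢ Set.Icc q.2 p.2) where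
  nonempty := ⟨p, hp, ⟨le_rfl, h₁⟩, h₂, le_rfl⟩
  convex x hx y hy z hxz hzy :=
    ⟨hI.convex x hx.1 y hy.1 z hxz hzy, ⟨hx.2.1.1.trans hxz.1, hzy.1.trans hy.2.1.2⟩,
      hx.2.2.1.trans hxz.2, hzy.2.trans hy.2.2.2⟩
  connected x hx y hy := by
    rw [← clampToRectangle_eq_self hx.2, ← clampToRectangle_eq_self hy.2]
    exact (hI.connected x hx.1 y hy.1).lift (clampToRectangle p q) fun a b h =>
      ⟨⟨hI.clampToRectangle_mem hp hq h₁ h₂ h.1, _root_.clampToRectangle_mem h₁ h₂ b⟩,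
        h.2.imp (fun h => clampToRectangle_mono p q h) fun h => clampToRectangle_mono p q h⟩

theorem exists_fiberPath_of_constant_snd (hI : IsPosetInterval I) (ρ₁ : α →o A) {ρ₂ : β →o B}
    (hleft : ∀ x ∈ I, p.1 ≤ x.1) (hconst : ∀ x ∈ I, ∀ y ∈ I, ρ₂ x.2 = ρ₂ y.2)
    (hp : p ∈ I) (hq : q ∈ I) {c : α} (hpc : p.1 ≤ c) (hcq : c ≤ q.1) :
    ∃ z ∈ I, z.1 = c ∧ Relation.ReflTransGen (FiberStep (ρ₁.prodMap ρ₂) I) p z := by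
  have hpq := hI.connected p hp q hq
  clear hq
  induction hpq generalizing c with
  | refl => exact ⟨p, hp, le_antisymm hpc hcq, .refl⟩
  | @tail s t hs hst ih =>
    rcases le_or_gt c s.1 with h | h
    · exact ih hpc h
    have hsI : s ∈ I := by
      rcases hs.cases_tail with rfl | ⟨_, -, hs⟩
      exacts [hp, hs.1]
    have hst' : s ≤ t := hst.2.resolve_right fun hts => h.not_ge (hcq.trans hts.1)
    obtain ⟨z, hz, hzs, hpath⟩ := ih (hleft s hsI) le_rfl
    have hcI : (c, s.2) ∈ I := hI.convex s hsI t hst.1 _ ⟨h.le, le_rfl⟩ ⟨hcq, hst'.2⟩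
    exact ⟨(c, s.2), hcI, rfl, (hpath.tail (.of_fst_eq hz hsI hzs (hconst z hz s hsI))).tail
      ⟨hsI, hcI, .inl ⟨h.le, le_rfl⟩⟩⟩

theorem exists_fiberPath (hI : IsPosetInterval I) (ρ₁ : α →o A) {ρ₂ : β →o B} (hp : p ∈ I)
    (hq : q ∈ I) (h₂ : q.2 ≤ p.2) (hρ₂ : ρ₂ p.2 = ρ₂ q.2) {c : α} (hpc : p.1 ≤ c)
    (hcq : c ≤ q.1) :
    ∃ z ∈ I, z.1 = c ∧ ρ₂ z.2 = ρ₂ q.2 ∧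
      Relation.ReflTransGen (FiberStep (ρ₁.prodMap ρ₂) I) p z := by
  have h₁ := hpc.trans hcq
  have hheight : ∀ x ∈ I ∩ Set.Icc p.1 q.1 ×ˢ Set.Icc q.2 p.2, ρ₂ x.2 = ρ₂ q.2 := fun x hx =>
    le_antisymm ((ρ₂.monotone hx.2.2.2).trans hρ₂.le) (ρ₂.monotone hx.2.2.1)
  obtain ⟨z, hz, hzc, hpath⟩ := (hI.inter_rectangle hp hq h₁ h₂).exists_fiberPath_of_constant_snd
    ρ₁ (fun x hx => hx.2.1.1) (fun x hx y hy => (hheight x hx).trans (hheight y hy).symm)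
    ⟨hp, ⟨le_rfl, h₁⟩, h₂, le_rfl⟩ ⟨hq, ⟨h₁, le_rfl⟩, le_rfl, h₂⟩ hpc hcq
  exact ⟨z, hz.1, hzc, hheight z hz,
    hpath.lift id fun _ _ h => h.mono Set.inter_subset_left⟩

end IsPosetInterval

/-- The properties of a monotone map which make every interval of its source and the saturation of
that interval by fibres interchangeable for modules pulled back along the map. -/
structure IsIntervalSaturated {P Q : Type*} [PartialOrder P] [PartialOrder Q] (ρ : P →o Q) :
    Prop where
  path : ∀ {I : Set P}, IsPosetInterval I → ∀ {p q : P}, p ∈ I → q ∈ I → ρ p ≤ ρ q →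
    Relation.ReflTransGen (FiberStep ρ I) p q
  between : ∀ {I : Set P}, IsPosetInterval I → ∀ {p q r : P}, p ∈ I → q ∈ I → ρ p ≤ ρ r →
    ρ r ≤ ρ q → ∃ t ∈ I, ρ t = ρ r
  join : ∀ {p q : P}, ρ p = ρ q → ∃ r, p ≤ r ∧ q ≤ r ∧ ρ r = ρ p

section Product

variable (ρ₁ : α →o A) (ρ₂ : β →o B) {I : Set (α × β)} {p q r : α × β}

theorem fiberPath_of_fst_le (hI : IsPosetInterval I) (hp : p ∈ I) (hq : q ∈ I)
    (hle : ρ₂ p.2 ≤ ρ₂ q.2) (h : p.1 ≤ q.1) :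
    Relation.ReflTransGen (FiberStep (ρ₁.prodMap ρ₂) I) p q := by
  rcases le_total p.2 q.2 with h₂ | h₂
  · exact .single ⟨hp, hq, .inl ⟨h, h₂⟩⟩
  obtain ⟨z, hz, hzq, hz₂, hpath⟩ :=
    hI.exists_fiberPath ρ₁ hp hq h₂ (le_antisymm hle (ρ₂.monotone h₂)) h le_rfl
  exact hpath.tail (.of_fst_eq hz hq hzq hz₂)

theorem fiberPath_prodMap (hI : IsPosetInterval I) (hp : p ∈ I) (hq : q ∈ I)
    (hle : ρ₁.prodMap ρ₂ p ≤ ρ₁.prodMap ρ₂ q) :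
    Relation.ReflTransGen (FiberStep (ρ₁.prodMap ρ₂) I) p q := by
  rcases le_total p.1 q.1 with h₁ | h₁
  · exact fiberPath_of_fst_le ρ₁ ρ₂ hI hp hq hle.2 h₁
  rcases le_total p.2 q.2 with h₂ | h₂
  · refine (fiberPath_of_fst_le ρ₂ ρ₁ hI.preimage_swap (p := p.swap) (q := q.swap) hp hq hle.1
      h₂).lift Prod.swap fun a b hab => ⟨hab.1, hab.2.1, hab.2.2.imp Prod.swap_le_swap.mpr ?_⟩
    exact fun h => ⟨Prod.swap_le_swap.mpr h.1, congrArg Prod.swap h.2⟩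
  · exact .single ⟨hp, hq, .inr ⟨⟨h₁, h₂⟩,
      le_antisymm hle ((ρ₁.prodMap ρ₂).monotone ⟨h₁, h₂⟩)⟩⟩

theorem exists_between_map_eq (σ : α →o A) {a b x : α} (hab : a ≤ b) (hax : σ a ≤ σ x)
    (hxb : σ x ≤ σ b) : ∃ c, a ≤ c ∧ c ≤ b ∧ σ c = σ x := by
  rcases le_total x a with h | h
  · exact ⟨a, le_rfl, hab, le_antisymm hax (σ.monotone h)⟩
  rcases le_total b x with h' | h'
  · exact ⟨b, hab, le_rfl, le_antisymm (σ.monotone h') hxb⟩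
  · exact ⟨x, h, h', rfl⟩

theorem exists_mem_fiber_of_fst_le (hI : IsPosetInterval I) (hp : p ∈ I) (hq : q ∈ I)
    (hpr : ρ₁.prodMap ρ₂ p ≤ ρ₁.prodMap ρ₂ r) (hrq : ρ₁.prodMap ρ₂ r ≤ ρ₁.prodMap ρ₂ q)
    (h : p.1 ≤ q.1) : ∃ t ∈ I, ρ₁.prodMap ρ₂ t = ρ₁.prodMap ρ₂ r := by
  obtain ⟨c, hpc, hcq, hc⟩ := exists_between_map_eq ρ₁ h hpr.1 hrq.1
  rcases le_total p.2 q.2 with h₂ | h₂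
  · obtain ⟨d, hpd, hdq, hd⟩ := exists_between_map_eq ρ₂ h₂ hpr.2 hrq.2
    exact ⟨(c, d), hI.convex p hp q hq _ ⟨hpc, hpd⟩ ⟨hcq, hdq⟩, Prod.ext hc hd⟩
  · have hqp := ρ₂.monotone h₂
    obtain ⟨z, hz, hzc, hzq, -⟩ := hI.exists_fiberPath ρ₁ hp hq h₂
      (le_antisymm (hpr.2.trans hrq.2) hqp) hpc hcq
    exact ⟨z, hz, Prod.ext ((congrArg ρ₁ hzc).trans hc)
      (hzq.trans (le_antisymm (hqp.trans hpr.2) hrq.2))⟩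

theorem exists_mem_fiber_prodMap (hI : IsPosetInterval I) (hp : p ∈ I) (hq : q ∈ I)
    (hpr : ρ₁.prodMap ρ₂ p ≤ ρ₁.prodMap ρ₂ r) (hrq : ρ₁.prodMap ρ₂ r ≤ ρ₁.prodMap ρ₂ q) :
    ∃ t ∈ I, ρ₁.prodMap ρ₂ t = ρ₁.prodMap ρ₂ r := by
  rcases le_total p.1 q.1 with h₁ | h₁
  · exact exists_mem_fiber_of_fst_le ρ₁ ρ₂ hI hp hq hpr hrq h₁
  rcases le_total p.2 q.2 with h₂ | h₂
  · obtain ⟨t, ht, htr⟩ := exists_mem_fiber_of_fst_le ρ₂ ρ₁ hI.preimage_swap (p := p.swap)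
      (q := q.swap) (r := r.swap) hp hq ⟨hpr.2, hpr.1⟩ ⟨hrq.2, hrq.1⟩ h₂
    exact ⟨t.swap, ht, congrArg Prod.swap htr⟩
  · exact ⟨p, hp, le_antisymm hpr (hrq.trans ((ρ₁.prodMap ρ₂).monotone ⟨h₁, h₂⟩))⟩

theorem map_sup_eq_of_map_eq (σ : α →o A) {a b : α} (h : σ a = σ b) : σ (a ⊔ b) = σ a := by
  rcases le_total a b with hab | hab
  · rw [sup_eq_right.mpr hab, h]
  · rw [sup_eq_left.mpr hab]

theorem isIntervalSaturated_prodMap : IsIntervalSaturated (ρ₁.prodMap ρ₂) where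
  path hI _ _ hp hq hle := fiberPath_prodMap ρ₁ ρ₂ hI hp hq hle
  between hI _ _ _ hp hq hpr hrq := exists_mem_fiber_prodMap ρ₁ ρ₂ hI hp hq hpr hrq
  join {p q} h := by
    obtain ⟨h₁, h₂⟩ := Prod.ext_iff.mp h
    exact ⟨p ⊔ q, le_sup_left, le_sup_right,
      Prod.ext (map_sup_eq_of_map_eq ρ₁ h₁) (map_sup_eq_of_map_eq ρ₂ h₂)⟩

end Product

end ProductIntervals

/-! ### Generalized rank and restriction of intervals -/

section GenRank

universe w

variable {F : Type*} [Field F] {P : Type*} [PartialOrder P] (M : PersistenceModule.{w} F P)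

theorem PersistenceModule.map_map {p q r : P} (h : p ≤ q) (h' : q ≤ r) (x : M.obj p) :
    M.map h' (M.map h x) = M.map (h.trans h') x :=
  (M.map_comp h h' x).symm

variable {M} in
theorem gpdSize_eq_ncard_support {f : PosetInt P → ℤ} (hf : IsGPD M f) :
    gpdSize M = (Function.support f).ncard := by
  have h : ∃ f, IsGPD M f := ⟨f, hf⟩
  rw [gpdSize, gpd, dif_pos h, h.choose_spec.unique hf]

theorem genRank_eq_finrank (I : PosetInt P) (p : I.1) :
    genRank M I = Module.finrank F (LinearMap.range (pmLimToColim M I.1 p)) := by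
  rw [genRank, pmLimToColim_eq M I _ p]

/-- The restriction of sections to a subset, that is, the contravariance of the limit in the
subset. -/
def pmLimitRestrict {I J : Set P} (h : I ⊆ J) : pmLimit M J →ₗ[F] pmLimit M I :=
  (LinearMap.pi fun p : I => pmLimitProj M J ⟨p, h p.2⟩).codRestrict _
    fun s p q hpq => s.2 ⟨p, h p.2⟩ ⟨q, h q.2⟩ hpq

open Classical in
/-- The map between colimits induced by the inclusion of a subset, that is, the covariance of the
colimit in the subset. -/
noncomputable def pmColimitMap {I J : Set P} (h : I ⊆ J) : PmColimit M I →ₗ[F] PmColimit M J :=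
  Module.DirectLimit.lift F I _ _ (fun p : I => pmColimitIncl M J ⟨p, h p.2⟩)
    fun p q hpq => pmColimitIncl_map M J (a := ⟨p, h p.2⟩) (b := ⟨q, h q.2⟩) hpq

theorem pmColimitMap_incl {I J : Set P} (h : I ⊆ J) (p : I) (x : M.obj p) :
    pmColimitMap M h (pmColimitIncl M I p x) = pmColimitIncl M J ⟨p, h p.2⟩ x := by
  classical exact Module.DirectLimit.lift_of _ _ _

theorem genRank_eq_of_subset {I J : PosetInt P} (h : I.1 ⊆ J.1)
    (hsurj : Function.Surjective (pmLimitRestrict M h))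
    (hinj : Function.Injective (pmColimitMap M h)) : genRank M I = genRank M J := by
  obtain ⟨p, hp⟩ := I.2.nonempty
  have hfactor : pmLimToColim M J.1 ⟨p, h hp⟩ =
      (pmColimitMap M h).comp ((pmLimToColim M I.1 ⟨p, hp⟩).comp (pmLimitRestrict M h)) :=
    LinearMap.ext fun s => (pmColimitMap_incl M h ⟨p, hp⟩ (s.1 ⟨p, h hp⟩)).symm
  rw [genRank_eq_finrank M I ⟨p, hp⟩, genRank_eq_finrank M J ⟨p, h hp⟩, hfactor,
    LinearMap.range_comp, LinearMap.range_comp_of_range_eq_top _ (LinearMap.range_eq_top.mpr hsurj)]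
  exact (Submodule.equivMapOfInjective _ hinj _).finrank_eq

theorem pmColimitIncl_injective_of_top {I : Set P} (w : I) (hw : ∀ p ∈ I, p ≤ w.1) :
    Function.Injective (pmColimitIncl M I w) := by
  classical
  let retraction : PmColimit M I →ₗ[F] M.obj w.1 :=
    Module.DirectLimit.lift F I _ _ (fun p : I => M.map (hw p.1 p.2))
      fun p q h => M.map_map (show p.1 ≤ q.1 from h) (hw q.1 q.2)
  exact Function.LeftInverse.injective (g := retraction) fun v =>
    (Module.DirectLimit.lift_of _ _ _).trans (M.map_id _ _)

theorem genRank_eq_finrank_range_proj {I : PosetInt P} (w : I.1) (hw : ∀ p ∈ I.1, p ≤ w.1) :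
    genRank M I = Module.finrank F (LinearMap.range (pmLimitProj M I.1 w)) := by
  rw [genRank_eq_finrank M I w, pmLimToColim, LinearMap.range_comp]
  exact (Submodule.equivMapOfInjective _ (pmColimitIncl_injective_of_top M w hw) _).finrank_eq.symm

end GenRank

/-! ### Diagrams of pullbacks -/

section Saturation

universe w

variable {P Q : Type*} [PartialOrder P] [PartialOrder Q] {ρ : P →o Q} {I : Set P}

theorem IsIntervalSaturated.isPosetInterval_saturation (hρ : IsIntervalSaturated ρ)
    (hI : IsPosetInterval I) : IsPosetInterval (ρ ⁻¹' (ρ '' I)) where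
  nonempty := hI.nonempty.mono (Set.subset_preimage_image ρ I)
  convex := by
    rintro x ⟨p, hp, hpx⟩ y ⟨q, hq, hqy⟩ r hxr hry
    exact hρ.between hI hp hq (hpx ▸ ρ.monotone hxr) (hqy ▸ ρ.monotone hry)
  connected := by
    have hfiber : ∀ x y, y ∈ ρ ⁻¹' (ρ '' I) → ρ y = ρ x →
        Relation.ReflTransGen (fun a b => b ∈ ρ ⁻¹' (ρ '' I) ∧ (a ≤ b ∨ b ≤ a)) x y := by
      intro x y hy hyx
      obtain ⟨r, hyr, hxr, hr⟩ := hρ.join hyx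
      have hrI : r ∈ ρ ⁻¹' (ρ '' I) := by rwa [Set.mem_preimage, hr]
      exact (Relation.ReflTransGen.single ⟨hrI, .inl hxr⟩).tail ⟨hy, .inr hyr⟩
    rintro x ⟨p, hp, hpx⟩ y ⟨q, hq, hqy⟩
    refine ((hfiber x p ⟨p, hp, rfl⟩ hpx).trans ?_).trans (hfiber q y ⟨q, hq, hqy⟩ hqy.symm)
    exact (hI.connected p hp q hq).lift id fun a b h => ⟨⟨b, h.1, rfl⟩, h.2⟩

/-- The saturation of an interval by fibres of `ρ`, as an interval. -/
def IsIntervalSaturated.saturation (hρ : IsIntervalSaturated ρ) (I : PosetInt P) : PosetInt P :=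
  ⟨ρ ⁻¹' (ρ '' I.1), hρ.isPosetInterval_saturation I.2⟩

theorem IsIntervalSaturated.finite_range_saturation (hρ : IsIntervalSaturated ρ)
    (hfin : (Set.range ρ).Finite) : (Set.range hρ.saturation).Finite := by
  refine Set.Finite.of_finite_image (f := fun J : PosetInt P => J.1) ?_ Subtype.val_injective.injOn
  refine (hfin.finite_subsets.image (fun A => ρ ⁻¹' A)).subset ?_
  rintro _ ⟨_, ⟨I, rfl⟩, rfl⟩
  exact ⟨ρ '' I.1, Set.image_subset_range _ _, rfl⟩

variable {F : Type*} [Field F] (N : PersistenceModule.{w} F Q)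

/-- The value at `p` of a section of a pullback, as an element of `N.obj (ρ p)`: the maps of `N`
relate it to the value at `q` as soon as `ρ p ≤ ρ q`, even if `p ≤ q` fails. -/
def pullbackSectionValue (s : pmLimit (N.restrict ρ) I) (p : I) : N.obj (ρ p) := s.1 p

/-- The inclusion of the value of a pullback at `p` into its colimit, with source
`N.obj (ρ p)`. -/
noncomputable def pullbackColimitIncl (ρ : P →o Q) (I : Set P) (p : I) :
    N.obj (ρ p) →ₗ[F] PmColimit (N.restrict ρ) I :=
  pmColimitIncl (N.restrict ρ) I p

theorem map_pullbackSectionValue (s : pmLimit (N.restrict ρ) I) {p q : I} (h : p.1 ≤ q.1) :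
    N.map (ρ.monotone h) (pullbackSectionValue N s p) = pullbackSectionValue N s q :=
  s.2 p q h

theorem pullbackColimitIncl_map {p q : I} (h : p.1 ≤ q.1) (v : N.obj (ρ p)) :
    pullbackColimitIncl N ρ I q (N.map (ρ.monotone h) v) = pullbackColimitIncl N ρ I p v :=
  pmColimitIncl_map (N.restrict ρ) I h v

theorem map_pullbackSectionValue_of_fiberPath (s : pmLimit (N.restrict ρ) I) (p : I) {q : P}
    (h : Relation.ReflTransGen (FiberStep ρ I) p q) :
    ∃ (hq : q ∈ I) (hle : ρ p ≤ ρ q),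
      N.map hle (pullbackSectionValue N s p) = pullbackSectionValue N s ⟨q, hq⟩ := by
  induction h with
  | refl => exact ⟨p.2, le_rfl, N.map_id _ _⟩
  | @tail a b _ hab ih =>
    obtain ⟨ha, hpa, hpa'⟩ := ih
    obtain ⟨-, hb, h | ⟨h, he⟩⟩ := hab
    · refine ⟨hb, hpa.trans (ρ.monotone h), ?_⟩
      rw [← map_pullbackSectionValue N s (p := ⟨a, ha⟩) (q := ⟨b, hb⟩) h, ← hpa', N.map_map]
    · refine ⟨hb, hpa.trans he.le, ?_⟩
      rw [← N.map_map hpa he.le, hpa',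
        ← map_pullbackSectionValue N s (p := ⟨b, hb⟩) (q := ⟨a, ha⟩) h, N.map_map, N.map_id]

theorem pullbackColimitIncl_map_of_fiberPath (p : I) {q : P}
    (h : Relation.ReflTransGen (FiberStep ρ I) p q) :
    ∃ (hq : q ∈ I) (hle : ρ p ≤ ρ q), ∀ v : N.obj (ρ p),
      pullbackColimitIncl N ρ I ⟨q, hq⟩ (N.map hle v) = pullbackColimitIncl N ρ I p v := by
  induction h with
  | refl => exact ⟨p.2, le_rfl, fun v => by rw [N.map_id]⟩
  | @tail a b _ hab ih =>
    obtain ⟨ha, hpa, hpa'⟩ := ih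
    obtain ⟨-, hb, h | ⟨h, he⟩⟩ := hab
    · refine ⟨hb, hpa.trans (ρ.monotone h), fun v => ?_⟩
      rw [← hpa' v, ← pullbackColimitIncl_map N (p := ⟨a, ha⟩) (q := ⟨b, hb⟩) h, N.map_map]
    · refine ⟨hb, hpa.trans he.le, fun v => ?_⟩
      rw [← hpa' v, ← pullbackColimitIncl_map N (p := ⟨b, hb⟩) (q := ⟨a, ha⟩) h, N.map_map]

theorem IsIntervalSaturated.map_pullbackSectionValue (hρ : IsIntervalSaturated ρ)
    (hI : IsPosetInterval I) (s : pmLimit (N.restrict ρ) I) (p q : I) (h : ρ p ≤ ρ q) :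
    N.map h (pullbackSectionValue N s p) = pullbackSectionValue N s q := by
  obtain ⟨_, _, e⟩ := map_pullbackSectionValue_of_fiberPath N s p (hρ.path hI p.2 q.2 h)
  exact e

theorem IsIntervalSaturated.pullbackColimitIncl_map (hρ : IsIntervalSaturated ρ)
    (hI : IsPosetInterval I) (p q : I) (h : ρ p ≤ ρ q) (v : N.obj (ρ p)) :
    pullbackColimitIncl N ρ I q (N.map h v) = pullbackColimitIncl N ρ I p v := by
  obtain ⟨_, _, e⟩ := pullbackColimitIncl_map_of_fiberPath N p (hρ.path hI p.2 q.2 h)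
  exact e v

theorem IsIntervalSaturated.pmLimitRestrict_surjective (hρ : IsIntervalSaturated ρ)
    (hI : IsPosetInterval I) :
    Function.Surjective (pmLimitRestrict (N.restrict ρ) (Set.subset_preimage_image ρ I)) := by
  intro s
  choose r hr hre using fun x : (ρ ⁻¹' (ρ '' I) : Set P) => x.2
  let t : ∀ x : (ρ ⁻¹' (ρ '' I) : Set P), N.obj (ρ x) := fun x =>
    N.map (hre x).le (pullbackSectionValue N s ⟨r x, hr x⟩)
  have ht : ∀ (x y : (ρ ⁻¹' (ρ '' I) : Set P)) (h : x.1 ≤ y.1),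
      N.map (ρ.monotone h) (t x) = t y := by
    intro x y h
    have hxy : ρ (r x) ≤ ρ (r y) := by rw [hre x, hre y]; exact ρ.monotone h
    simp only [t]
    rw [← hρ.map_pullbackSectionValue N hI s ⟨r x, hr x⟩ ⟨r y, hr y⟩ hxy, N.map_map, N.map_map]
  exact ⟨⟨t, ht⟩, Subtype.ext <| funext fun p =>
    hρ.map_pullbackSectionValue N hI s ⟨r _, hr _⟩ p (hre _).le⟩

theorem IsIntervalSaturated.pmColimitMap_injective (hρ : IsIntervalSaturated ρ)
    (hI : IsPosetInterval I) :
    Function.Injective (pmColimitMap (N.restrict ρ) (Set.subset_preimage_image ρ I)) := by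
  classical
  choose r hr hre using fun x : (ρ ⁻¹' (ρ '' I) : Set P) => x.2
  have hcompat : ∀ (x y : (ρ ⁻¹' (ρ '' I) : Set P)) (h : x.1 ≤ y.1) (v : N.obj (ρ x)),
      pullbackColimitIncl N ρ I ⟨r y, hr y⟩ (N.map (hre y).ge (N.map (ρ.monotone h) v)) =
        pullbackColimitIncl N ρ I ⟨r x, hr x⟩ (N.map (hre x).ge v) := by
    intro x y h v
    have hxy : ρ (r x) ≤ ρ (r y) := by rw [hre x, hre y]; exact ρ.monotone h
    rw [← hρ.pullbackColimitIncl_map N hI ⟨r x, hr x⟩ ⟨r y, hr y⟩ hxy, N.map_map, N.map_map]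
  let retraction : PmColimit (N.restrict ρ) (ρ ⁻¹' (ρ '' I)) →ₗ[F] PmColimit (N.restrict ρ) I :=
    Module.DirectLimit.lift F _ _ _
      (fun x : (ρ ⁻¹' (ρ '' I) : Set P) =>
        (pullbackColimitIncl N ρ I ⟨r x, hr x⟩).comp (N.map (hre x).ge))
      hcompat
  have hretraction : retraction.comp (pmColimitMap _ (Set.subset_preimage_image ρ I)) =
      LinearMap.id := by
    refine Module.DirectLimit.hom_ext fun p => LinearMap.ext fun v => ?_
    refine (congrArg retraction
      (pmColimitMap_incl _ (Set.subset_preimage_image ρ I) p v)).trans ?_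
    exact (Module.DirectLimit.lift_of _ _ _).trans
      (hρ.pullbackColimitIncl_map N hI p ⟨r _, hr _⟩
        (hre ⟨p, Set.subset_preimage_image ρ I p.2⟩).ge v)
  exact Function.LeftInverse.injective (g := retraction) (LinearMap.congr_fun hretraction)

theorem IsIntervalSaturated.genRank_saturation (hρ : IsIntervalSaturated ρ) (I : PosetInt P) :
    genRank (N.restrict ρ) (hρ.saturation I) = genRank (N.restrict ρ) I :=
  (genRank_eq_of_subset (J := hρ.saturation I) _ (Set.subset_preimage_image ρ I.1)
    (hρ.pmLimitRestrict_surjective N I.2) (hρ.pmColimitMap_injective N I.2)).symm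

theorem finsum_mem_eq_sum_filter_of_support_subset {T : Type*} {s : Finset T} {f : T → ℤ}
    (hf : Function.support f ⊆ s) (p : T → Prop) [DecidablePred p] :
    ∑ᶠ (x : T) (_ : p x), f x = ∑ x ∈ s with p x, f x := by
  refine finsum_mem_eq_sum_of_inter_support_eq (s := {x | p x}) f (Set.ext fun x => ?_)
  have := @hf x
  simp only [Set.mem_inter_iff, Set.mem_ofPred_eq, Finset.coe_filter, SetLike.mem_coe] at this ⊢
  tauto

/-- Möbius inversion, one minimal element of `s` at a time. -/
theorem exists_forall_eq_finsum_ge {T : Type*} [PartialOrder T] (s : Finset T) (r : T → ℤ) :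
    ∃ f : T → ℤ, Function.support f ⊆ s ∧ ∀ x ∈ s, r x = ∑ᶠ (y : T) (_ : x ≤ y), f y := by
  classical
  induction s using Finset.strongInduction with
  | H s ih =>
  rcases s.eq_empty_or_nonempty with rfl | hs
  · exact ⟨0, by simp, by simp⟩
  obtain ⟨m, hm⟩ := s.exists_minimal hs
  obtain ⟨f, hf, hfr⟩ := ih (s.erase m) (Finset.erase_ssubset hm.prop)
  have hfs : Function.support f ⊆ s := hf.trans (Finset.coe_subset.mpr (s.erase_subset m))
  have hfm : f m = 0 := by
    by_contra h
    exact s.notMem_erase m (hf h)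
  set g := Function.update f m (r m - ∑ y ∈ s with m ≤ y, f y) with hg
  have hgs : Function.support g ⊆ s := by
    intro x hx
    rcases eq_or_ne x m with rfl | hxm
    · exact hm.prop
    · rw [Function.mem_support, hg, Function.update_of_ne hxm] at hx
      exact hfs hx
  refine ⟨g, hgs, fun x hx => ?_⟩
  rw [finsum_mem_eq_sum_filter_of_support_subset hgs]
  rcases eq_or_ne x m with rfl | hxm
  · have hmem : x ∈ s.filter (x ≤ ·) := Finset.mem_filter.mpr ⟨hx, le_rfl⟩
    rw [Finset.sum_update_of_mem hmem, ← Finset.erase_eq, ← Finset.add_sum_erase _ f hmem, hfm]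
    ring
  · rw [hfr x (Finset.mem_erase.mpr ⟨hxm, hx⟩), finsum_mem_eq_sum_filter_of_support_subset hfs]
    refine Finset.sum_congr rfl fun y hy => (Function.update_of_ne ?_ _ _).symm
    rintro rfl
    exact hxm (hm.eq_of_le hx (Finset.mem_filter.mp hy).2)

theorem IsIntervalSaturated.exists_isGPD (hρ : IsIntervalSaturated ρ)
    (hfin : (Set.range ρ).Finite) :
    ∃ f, IsGPD (N.restrict ρ) f ∧ (Function.support f).Finite := by
  have hsat := hρ.finite_range_saturation hfin
  obtain ⟨f, hf, hrank⟩ :=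
    exists_forall_eq_finsum_ge hsat.toFinset fun I => (genRank (N.restrict ρ) I : ℤ)
  have hsupp : (Function.support f).Finite := hsat.toFinset.finite_toSet.subset hf
  refine ⟨f, fun I => ⟨hsupp.subset fun J hJ => hJ.2, ?_⟩, hsupp⟩
  rw [← hρ.genRank_saturation N I, hrank (hρ.saturation I) (by simp)]
  refine finsum_congr fun J => ?_
  rcases eq_or_ne (f J) 0 with hJ | hJ
  · simp [hJ]
  obtain ⟨K, rfl⟩ : J ∈ Set.range hρ.saturation := by simpa using hf hJ
  refine finsum_congr_Prop (propext ⟨(Set.subset_preimage_image ρ I.1).trans, ?_⟩) fun _ => rfl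
  rintro h x ⟨p, hp, hpx⟩
  obtain ⟨q, hq, hqp⟩ := h hp
  exact ⟨q, hq, hqp.trans hpx⟩

end Saturation

section DiagramSize

universe w

theorem eq_of_sum_powerset_eq_ite {ι : Type*} [DecidableEq ι] (H : Finset ι → ℤ)
    (h : ∀ U : Finset ι, ∑ U' ∈ U.powerset, H U' = if U = ∅ then 0 else 1) (U : Finset ι) :
    H U = (if U = ∅ then 1 else 0) - (-1) ^ U.card := by
  induction U using Finset.strongInduction with
  | H U ih =>
  have hsum : ∑ U' ∈ U.powerset, ((if U' = ∅ then 1 else 0) - (-1 : ℤ) ^ U'.card) =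
      if U = ∅ then 0 else 1 := by
    rw [Finset.sum_sub_distrib, Finset.sum_powerset_neg_one_pow_card, Finset.sum_ite_eq',
      if_pos (Finset.empty_mem_powerset U)]
    split_ifs <;> rfl
  have hproper : ∑ U' ∈ U.powerset.erase U, H U' =
      ∑ U' ∈ U.powerset.erase U, ((if U' = ∅ then 1 else 0) - (-1 : ℤ) ^ U'.card) := by
    refine Finset.sum_congr rfl fun U' hU' => ih U' ?_
    rw [Finset.mem_erase, Finset.mem_powerset] at hU'
    exact Finset.ssubset_iff_subset_ne.mpr hU'.symm
  have hU : U ∈ U.powerset := Finset.mem_powerset_self U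
  rw [← h, ← Finset.add_sum_erase _ _ hU, ← Finset.add_sum_erase _ H hU, hproper] at hsum
  exact (add_right_cancel hsum).symm

theorem two_pow_sub_one_le_card_of_sum_filter_subset {ι T : Type*} [Fintype ι] [DecidableEq ι]
    (s : Finset T) (f : T → ℤ) (miss : T → Finset ι)
    (h : ∀ U : Finset ι, ∑ x ∈ s with miss x ⊆ U, f x = if U = ∅ then 0 else 1) :
    2 ^ Fintype.card ι - 1 ≤ s.card := by
  have hfiber : ∀ U : Finset ι, ∑ x ∈ s with miss x = U, f x =
      (if U = ∅ then 1 else 0) - (-1) ^ U.card :=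
    eq_of_sum_powerset_eq_ite _ fun U => by
      simpa only [Finset.sum_fiberwise_eq_sum_filter, Finset.mem_powerset] using h U
  have himage : Finset.univ.erase ∅ ⊆ s.image miss := by
    intro U hU
    have hne : ∑ x ∈ s with miss x = U, f x ≠ 0 := by
      rw [hfiber, if_neg (Finset.ne_of_mem_erase hU)]
      simp
    obtain ⟨x, hx, -⟩ := Finset.exists_ne_zero_of_sum_ne_zero hne
    exact Finset.mem_image.mpr ⟨x, Finset.mem_filter.mp hx⟩
  have hcard := (Finset.card_le_card himage).trans Finset.card_image_le
  rwa [Finset.card_erase_of_mem (Finset.mem_univ _), Finset.card_univ, Fintype.card_finset] at hcard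

variable {F : Type*} [Field F] {P : Type*} [PartialOrder P] {M : PersistenceModule.{w} F P}

theorem IsGPD.two_pow_sub_one_le_ncard_support {ι : Type*} [Fintype ι] [DecidableEq ι]
    {f : PosetInt P → ℤ} (hf : IsGPD M f) (hfin : (Function.support f).Finite)
    (base : PosetInt P → Prop) (x : ι → P) (I : Finset ι → PosetInt P)
    (hI : ∀ U J, (I U).1 ⊆ J.1 ↔ base J ∧ ∀ k ∉ U, x k ∈ J.1)
    (hrank : ∀ U, genRank M (I U) = if U = ∅ then 0 else 1) :
    2 ^ Fintype.card ι - 1 ≤ (Function.support f).ncard := by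
  classical
  have hsum := two_pow_sub_one_le_card_of_sum_filter_subset (hfin.toFinset.filter base) f
    (fun J => {k | x k ∉ J.1}) fun U => by
    calc _ = ∑ J ∈ hfin.toFinset with (I U).1 ⊆ J.1, f J := by
          rw [Finset.filter_filter]
          refine Finset.sum_congr (Finset.filter_congr fun J _ => ?_) fun _ _ => rfl
          rw [hI, and_congr_right_iff]
          exact fun _ => ⟨fun h k hk => by_contra fun hkJ => hk (h (by simpa using hkJ)),
            fun h k hk => by_contra fun hkU => (Finset.mem_filter.mp hk).2 (h k hkU)⟩
      _ = genRank M (I U) := by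
          rw [(hf (I U)).2, finsum_mem_eq_sum_filter_of_support_subset hfin.coe_toFinset.ge]
      _ = if U = ∅ then 0 else 1 := by
          rw [hrank]
          split_ifs <;> rfl
  rw [Set.ncard_eq_toFinset_card _ hfin]
  exact hsum.trans (Finset.card_le_card (Finset.filter_subset _ _))

/-- The set of points below the cap `w` and above one of the points `x k`. When nonempty it is an
interval, and the intervals containing it are those containing `w` and all the `x k`. -/
def cappedUpperSet {κ : Type*} (w : P) (x : κ → P) : Set P := {p | p ≤ w ∧ ∃ k, x k ≤ p}

variable {κ : Type*} {w : P} {x : κ → P}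

theorem isPosetInterval_cappedUpperSet (hx : ∃ k, x k ≤ w) :
    IsPosetInterval (cappedUpperSet w x) where
  nonempty := ⟨w, le_rfl, hx⟩
  convex := by
    rintro p ⟨-, k, hkp⟩ q ⟨hq, -⟩ r hpr hrq
    exact ⟨hrq.trans hq, k, hkp.trans hpr⟩
  connected := by
    rintro p hp q hq
    exact (Relation.ReflTransGen.single ⟨⟨le_rfl, hx⟩, Or.inl hp.1⟩).tail ⟨hq, Or.inr hq.1⟩

theorem cappedUpperSet_subset_iff [Nonempty κ] (hx : ∀ k, x k ≤ w) {J : Set P}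
    (hJ : IsPosetInterval J) : cappedUpperSet w x ⊆ J ↔ w ∈ J ∧ ∀ k, x k ∈ J := by
  constructor
  · exact fun h => ⟨h ⟨le_rfl, Classical.arbitrary κ, hx _⟩, fun k => h ⟨hx k, k, le_rfl⟩⟩
  · rintro ⟨hw, hxJ⟩ p ⟨hp, k, hkp⟩
    exact hJ.convex _ (hxJ k) w hw p hkp hp

theorem exists_pmLimit_cappedUpperSet (w : P) (u : ∀ k, M.obj (x k))
    (hu : ∀ j k p (hj : x j ≤ p) (hk : x k ≤ p), M.map hj (u j) = M.map hk (u k)) :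
    ∃ s : pmLimit M (cappedUpperSet w x), ∀ p k (h : x k ≤ p.1),
      pmLimitProj M _ p s = M.map h (u k) := by
  choose k hk using fun p : cappedUpperSet w x => p.2.2
  refine ⟨⟨fun p => M.map (hk p) (u (k p)), fun p q h => ?_⟩, fun p j h => hu _ _ _ _ _⟩
  rw [M.map_map]
  exact hu _ _ _ _ _

/-- The last point of the row `n` of the grid, where the zigzag module is `F ^ (n + 1)`. -/
def zigzagApex (n : ℕ) : Fin (n + 2) × Fin (n + 2) := (Fin.last _, (Fin.last n).castSucc)

/-- The point of the grid at which the zigzag module is the `k`-th coordinate hyperplane. -/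
def zigzagDiag (n : ℕ) (k : Fin (n + 1)) : Fin (n + 2) × Fin (n + 2) := (k.castSucc, k.rev.castSucc)

theorem zigzagApex_le_top (n : ℕ) : zigzagApex n ≤ ⊤ := le_top

theorem zigzagDiag_le_apex {n : ℕ} (k : Fin (n + 1)) : zigzagDiag n k ≤ zigzagApex n :=
  ⟨Fin.le_last _, Fin.castSucc_le_castSucc_iff.mpr (Fin.le_last _)⟩

theorem zigzagApex_snd_le (n : ℕ) : ((zigzagApex n).2 : ℕ) ≤ n := by simp [zigzagApex]

theorem zigzagDiag_snd_le {n : ℕ} (k : Fin (n + 1)) : ((zigzagDiag n k).2 : ℕ) ≤ n :=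
  Nat.lt_succ_iff.mp k.rev.isLt

theorem zigzagDiag_fst_add_snd {n : ℕ} (k : Fin (n + 1)) :
    ((zigzagDiag n k).1 : ℕ) + (zigzagDiag n k).2 = n := by
  simp only [zigzagDiag, Fin.val_castSucc, Fin.val_rev]
  omega

theorem snd_top_grid (n : ℕ) : ((⊤ : Fin (n + 2) × Fin (n + 2)).2 : ℕ) = n + 1 := rfl

variable {n : ℕ}

section ZigzagStructure

variable {N : PersistenceModule.{w} F (Fin (n + 2) × Fin (n + 2))}

theorem HasZigzagStructure.finrank_top (hN : HasZigzagStructure n N) :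
    Module.finrank F (N.obj ⊤) = 1 := by
  obtain ⟨_, ψ, _, hψ, _⟩ := hN
  exact (LinearEquiv.ofBijective (ψ ⊤) (hψ ⊤ (snd_top_grid n))).finrank_eq.trans
    (Module.finrank_self F)

theorem HasZigzagStructure.map_injective (hN : HasZigzagStructure n N) {p q} (h : p ≤ q)
    (hq : (q.2 : ℕ) ≤ n) : Function.Injective (N.map h) := by
  obtain ⟨φ, _, hφ, _, hφφ, _⟩ := hN
  intro v v' hv
  exact (hφ p ((Fin.le_def.mp h.2).trans hq)).1 (by rw [← hφφ p q h hq, hv, hφφ p q h hq])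

theorem HasZigzagStructure.map_top_eq_zero (hN : HasZigzagStructure n N)
    {v : N.obj (zigzagApex n)}
    (hv : ∀ k, v ∈ LinearMap.range (N.map (zigzagDiag_le_apex k))) :
    N.map (zigzagApex_le_top n) v = 0 := by
  obtain ⟨φ, ψ, hφ, hψ, hφφ, hφψ, -⟩ := hN
  refine (hψ ⊤ (snd_top_grid n)).1 ?_
  rw [hφψ _ _ _ (zigzagApex_snd_le n) (snd_top_grid n), map_zero]
  refine Finset.sum_eq_zero fun k _ => ?_
  obtain ⟨v', rfl⟩ := hv k
  rw [hφφ _ _ _ (zigzagApex_snd_le n)]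
  exact (((hφ _ (zigzagDiag_snd_le k)).2 _).mp ⟨v', rfl⟩).2 (zigzagDiag_fst_add_snd k) k rfl

theorem HasZigzagStructure.exists_map_top_ne_zero (hN : HasZigzagStructure n N)
    (k₀ : Fin (n + 1)) :
    ∃ v : N.obj (zigzagApex n), N.map (zigzagApex_le_top n) v ≠ 0 ∧
      ∀ k, k ≠ k₀ → v ∈ LinearMap.range (N.map (zigzagDiag_le_apex k)) := by
  obtain ⟨φ, ψ, hφ, -, hφφ, hφψ, -⟩ := hN
  obtain ⟨v, hv⟩ : ∃ v, φ (zigzagApex n) v = Pi.single k₀ 1 :=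
    ((hφ _ (zigzagApex_snd_le n)).2 _).mpr ⟨fun h => absurd h (by simp [zigzagApex]),
      fun h => absurd h (by simp [zigzagApex])⟩
  refine ⟨v, fun h0 => ?_, fun k hk => ?_⟩
  · have hsum := hφψ _ _ (zigzagApex_le_top n) (zigzagApex_snd_le n) (snd_top_grid n) v
    simp [h0, hv] at hsum
  · obtain ⟨v', hv'⟩ : ∃ v', φ (zigzagDiag n k) v' = Pi.single k₀ 1 := by
      refine ((hφ _ (zigzagDiag_snd_le k)).2 _).mpr
        ⟨fun h => absurd h (zigzagDiag_fst_add_snd k).not_lt, fun _ l hl => ?_⟩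
      obtain rfl : l = k := Fin.ext hl
      exact Pi.single_eq_of_ne hk _
    refine ⟨v', (hφ _ (zigzagApex_snd_le n)).1 ?_⟩
    rw [hφφ _ _ _ (zigzagApex_snd_le n), hv, hv']

end ZigzagStructure

/-- The minimal points of the interval which avoids exactly the hyperplanes with index in `U`: the
apex and the diagonal points with index outside `U`. -/
def zigzagGenerator (n : ℕ) (U : Finset (Fin (n + 1))) :
    Option {k // k ∉ U} → Fin (n + 2) × Fin (n + 2) :=
  fun a => a.elim (zigzagApex n) fun k => zigzagDiag n k

theorem zigzagGenerator_le_apex (U : Finset (Fin (n + 1))) :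
    ∀ a, zigzagGenerator n U a ≤ zigzagApex n
  | none => le_rfl
  | some k => zigzagDiag_le_apex k.1

variable (g : Fin (n + 2) × Fin (n + 2) →o P) (U : Finset (Fin (n + 1)))

theorem zigzagGenerator_le_top (a) : g (zigzagGenerator n U a) ≤ g ⊤ := g.monotone le_top

/-- The interval of `P` between the generators with index outside `U` and the top of the grid, where
the grid is mapped to `P` by `g`. -/
def zigzagInterval : PosetInt P :=
  ⟨cappedUpperSet (g ⊤) (g ∘ zigzagGenerator n U),
    isPosetInterval_cappedUpperSet ⟨none, zigzagGenerator_le_top g U none⟩⟩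

theorem zigzagInterval_subset_iff (J : PosetInt P) :
    (zigzagInterval g U).1 ⊆ J.1 ↔ (g ⊤ ∈ J.1 ∧ g (zigzagApex n) ∈ J.1) ∧
      ∀ k ∉ U, g (zigzagDiag n k) ∈ J.1 :=
  (cappedUpperSet_subset_iff (zigzagGenerator_le_top g U) J.2).trans <| by
    simp only [Option.forall, Subtype.forall, zigzagGenerator, Option.elim,
      and_assoc]

/-- The top of the grid as a point of the interval generated by the hyperplanes outside `U`. -/
def zigzagIntervalTop : (zigzagInterval g U).1 :=
  ⟨g ⊤, le_rfl, none, zigzagGenerator_le_top g U none⟩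

theorem genRank_zigzagInterval :
    genRank M (zigzagInterval g U) = Module.finrank F
      (LinearMap.range (pmLimitProj M (zigzagInterval g U).1 (zigzagIntervalTop g U))) :=
  genRank_eq_finrank_range_proj M (zigzagIntervalTop g U) fun _ hp => hp.1

variable {g}

theorem genRank_zigzagInterval_empty (hz : HasZigzagStructure n (M.restrict g)) :
    genRank M (zigzagInterval g ∅) = 0 := by
  have hmem : ∀ a, g (zigzagGenerator n ∅ a) ∈ (zigzagInterval g ∅).1 := fun a =>
    ⟨zigzagGenerator_le_top g ∅ a, a, le_rfl⟩
  suffices h : pmLimitProj M (zigzagInterval g ∅).1 (zigzagIntervalTop g ∅) = 0 by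
    rw [genRank_zigzagInterval, h, LinearMap.range_zero, finrank_bot]
  refine LinearMap.ext fun s => ?_
  refine (s.2 ⟨_, hmem none⟩ (zigzagIntervalTop g ∅) (zigzagGenerator_le_top g ∅ none)).symm.trans
    (hz.map_top_eq_zero fun k => ?_)
  have hk := hmem (some ⟨k, Finset.notMem_empty k⟩)
  exact ⟨s.1 ⟨_, hk⟩, s.2 ⟨_, hk⟩ ⟨_, hmem none⟩ (g.monotone (zigzagDiag_le_apex k))⟩

theorem genRank_zigzagInterval_of_nonempty
    (hg : ∀ a b p, g a ≤ p → g b ≤ p → g (a ⊔ b) ≤ p)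
    (hz : HasZigzagStructure n (M.restrict g)) {U : Finset (Fin (n + 1))} (hU : U.Nonempty) :
    genRank M (zigzagInterval g U) = 1 := by
  obtain ⟨k₀, hk₀⟩ := hU
  obtain ⟨v, hv, hvk⟩ := hz.exists_map_top_ne_zero k₀
  have hlift : ∀ a, ∃ u, (M.restrict g).map (zigzagGenerator_le_apex U a) u = v := by
    rintro (_ | ⟨k, hk⟩)
    · exact ⟨v, (M.restrict g).map_id _ v⟩
    · exact hvk k (ne_of_mem_of_not_mem hk₀ hk).symm
  choose u hu using hlift
  have hcompat : ∀ a b p (ha : g (zigzagGenerator n U a) ≤ p) (hb : g (zigzagGenerator n U b) ≤ p),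
      M.map ha (u a) = M.map hb (u b) := by
    intro a b p ha hb
    set c := zigzagGenerator n U a ⊔ zigzagGenerator n U b
    have hc : c ≤ zigzagApex n := sup_le (zigzagGenerator_le_apex U a) (zigzagGenerator_le_apex U b)
    have hsup : (M.restrict g).map le_sup_left (u a) = (M.restrict g).map le_sup_right (u b) :=
      hz.map_injective hc (zigzagApex_snd_le n) <| by
        rw [PersistenceModule.map_map, PersistenceModule.map_map, hu, hu]
    have hmap := congrArg (M.map (hg _ _ p ha hb)) hsup
    exact ((M.map_map _ _ _).symm.trans hmap).trans (M.map_map _ _ _)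
  obtain ⟨s, hs⟩ : ∃ s : pmLimit M (zigzagInterval g U).1,
      ∀ p a (h : g (zigzagGenerator n U a) ≤ p.1), pmLimitProj M _ p s = M.map h (u a) :=
    exists_pmLimit_cappedUpperSet (g ⊤) u hcompat
  have hs_top : pmLimitProj M (zigzagInterval g U).1 (zigzagIntervalTop g U) s ≠ 0 := by
    rw [hs (zigzagIntervalTop g U) none (zigzagGenerator_le_top g U none)]
    have hnone : u none = v := ((M.restrict g).map_id _ _).symm.trans (hu none)
    rw [hnone]
    exact hv
  rw [genRank_zigzagInterval]
  refine le_antisymm ((Submodule.finrank_le _).trans_eq hz.finrank_top) ?_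
  refine Nat.one_le_iff_ne_zero.mpr fun h0 => hs_top ?_
  exact LinearMap.congr_fun (LinearMap.range_eq_bot.mp (Submodule.finrank_eq_zero.mp h0)) s

theorem two_pow_le_gpdSize_of_restrict
    (hg : ∀ a b p, g a ≤ p → g b ≤ p → g (a ⊔ b) ≤ p) (hz : HasZigzagStructure n (M.restrict g))
    (hM : ∃ f, IsGPD M f ∧ (Function.support f).Finite) : 2 ^ (n + 1) - 1 ≤ gpdSize M := by
  obtain ⟨f, hf, hfin⟩ := hM
  rw [gpdSize_eq_ncard_support hf]
  have hcard := hf.two_pow_sub_one_le_ncard_support hfin _ _ (zigzagInterval g)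
    (zigzagInterval_subset_iff g) fun U => by
    split_ifs with hU
    · rw [hU, genRank_zigzagInterval_empty hz]
    · exact genRank_zigzagInterval_of_nonempty hg hz (Finset.nonempty_iff_ne_empty.mpr hU)
  rwa [Fintype.card_fin] at hcard

theorem HasZigzagStructure.two_pow_le_gpdSize
    {N : PersistenceModule.{w} F (Fin (n + 2) × Fin (n + 2))} (hN : HasZigzagStructure n N) :
    2 ^ (n + 1) - 1 ≤ gpdSize N := by
  refine two_pow_le_gpdSize_of_restrict (M := N) (g := OrderHom.id) (fun a b p => sup_le) hN ?_
  exact (isIntervalSaturated_prodMap (OrderHom.id (α := Fin (n + 2)))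
    (OrderHom.id (α := Fin (n + 2)))).exists_isGPD N (Set.toFinite _)

end DiagramSize

section DegreeBifiltrationDiagram

variable {V : Type*} [Finite V]

theorem ncard_complexNeighbors_mono {K L : PreAbstractSimplicialComplex V} (h : K ≤ L) (x : V) :
    (complexNeighbors K x).ncard ≤ (complexNeighbors L x).ncard :=
  Set.ncard_le_ncard (fun _ ⟨hy, σ, hσ, hσxy⟩ => ⟨hy, σ, h hσ, hσxy⟩) (Set.toFinite _)

theorem ncard_complexNeighbors_le_card (K : PreAbstractSimplicialComplex V) (x : V) :
    (complexNeighbors K x).ncard ≤ Nat.card V := by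
  rw [← Set.ncard_univ]
  exact Set.ncard_le_ncard (Set.subset_univ _) (Set.toFinite _)

/-- The subcomplex of a complex spanned by the vertices of degree at least `d - 1`, as a monotone
function of the pair of `d` and the complex. -/
def degreeSubcomplex : ℤᵒᵈ × PreAbstractSimplicialComplex V →o PreAbstractSimplicialComplex V where
  toFun p :=
    { faces := {σ | σ ∈ p.2 ∧
        ∀ x ∈ σ, OrderDual.ofDual p.1 - 1 ≤ ((complexNeighbors p.2 x).ncard : ℤ)}
      isRelLowerSet_faces := fun {_} hσ =>
        ⟨(p.2.isRelLowerSet_faces hσ.1).1, fun _ hτσ hτ =>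
          ⟨(p.2.isRelLowerSet_faces hσ.1).2 hτσ hτ, fun x hx => hσ.2 x (hτσ hx)⟩⟩ }
  monotone' := fun _ _ ⟨hd, hK⟩ _ hσ => ⟨hK hσ.1, fun x hx =>
    (sub_le_sub_right (OrderDual.ofDual_le_ofDual.mpr hd) 1).trans
      ((hσ.2 x hx).trans (Nat.cast_le.mpr (ncard_complexNeighbors_mono hK x)))⟩

/-- The truncation of degrees to the range `0, …, m + 2`. On a complex with at most `m` vertices,
requiring degree at least `d - 1` depends only on the truncation of `d`. -/
def clampDegree (m : ℕ) : ℤᵒᵈ →o ℤᵒᵈ where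
  toFun d := OrderDual.toDual (max 0 (min (OrderDual.ofDual d) (m + 2)))
  monotone' _ _ h := max_le_max le_rfl (min_le_min (OrderDual.ofDual_le_ofDual.mpr h) le_rfl)

theorem clampDegree_mem_Icc (m : ℕ) (d : ℤᵒᵈ) :
    clampDegree m d ∈ Set.Icc (OrderDual.toDual ((m : ℤ) + 2)) (OrderDual.toDual 0) :=
  ⟨OrderDual.toDual_le_toDual.mpr (max_le (by positivity) (min_le_right _ _)),
    OrderDual.toDual_le_toDual.mpr (le_max_left _ _)⟩

theorem degreeBifiltration_eq_comp (K : ℝ≥0 →o PreAbstractSimplicialComplex V) :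
    degreeBifiltration K = degreeSubcomplex.comp ((clampDegree (Nat.card V)).prodMap K) := by
  refine OrderHom.ext _ _ (funext fun p => PreAbstractSimplicialComplex.ext (Set.ext fun σ => ?_))
  refine and_congr_right fun _ => forall₂_congr fun x _ => ?_
  have hcard := ncard_complexNeighbors_le_card (K p.2) x
  change OrderDual.ofDual p.1 - 1 ≤ _ ↔
    max 0 (min (OrderDual.ofDual p.1) _) - 1 ≤ ((complexNeighbors (K p.2) x).ncard : ℤ)
  omega

instance finite_preAbstractSimplicialComplex : Finite (PreAbstractSimplicialComplex V) :=
  Finite.of_injective (fun K => K.faces) fun _ _ => PreAbstractSimplicialComplex.ext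

theorem exists_isGPD_degreeBifiltration (F : Type*) [Field F]
    (K : ℝ≥0 →o PreAbstractSimplicialComplex V) (m : ℕ) :
    ∃ f, IsGPD (filtrationHomology F (degreeBifiltration K) m) f ∧
      (Function.support f).Finite := by
  rw [degreeBifiltration_eq_comp]
  refine (isIntervalSaturated_prodMap (clampDegree (Nat.card V)) K).exists_isGPD
    (filtrationHomology F degreeSubcomplex m) ?_
  refine ((Set.finite_Icc (OrderDual.toDual ((Nat.card V : ℤ) + 2)) (OrderDual.toDual 0)).prod
    (Set.toFinite Set.univ)).subset ?_
  rintro _ ⟨p, rfl⟩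
  exact ⟨clampDegree_mem_Icc _ p.1, Set.mem_univ _⟩

end DegreeBifiltrationDiagram

/-! ### Detecting first homology by cocycles -/

section Cocycles

universe u v

/-- Two functions on the edges of a graph with adjacency relation `R` are cohomologous if they
differ by the coboundary of a function on the vertices. -/
def Cohomologous {V A : Type*} [AddCommGroup A] (R : V → V → Prop) (f f' : V → V → A) : Prop :=
  ∃ g : V → A, ∀ a b, R a b → f a b = f' a b + (g b - g a)

variable {F : Type u} [Field F] {V : Type v} {K L : PreAbstractSimplicialComplex V}

theorem SpansSimplex.of_range_subset {m k : ℕ} {s : Fin m → V} {t : Fin (k + 1) → V}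
    (hs : SpansSimplex K s) (h : Set.range t ⊆ Set.range s) : SpansSimplex K t := by
  classical
  obtain ⟨σ, hσ, hσs⟩ := hs
  refine ⟨Finset.univ.image t, (K.isRelLowerSet_faces hσ).2 ?_ ⟨t 0, by simp⟩, by simp⟩
  rw [← hσs] at h
  simpa [← Finset.coe_subset] using h

theorem SpansSimplex.pair {m : ℕ} {s : Fin m → V} (hs : SpansSimplex K s) (i j : Fin m) :
    SpansSimplex K ![s i, s j] :=
  hs.of_range_subset (by simp [Set.insert_subset_iff])

theorem SpansSimplex.triple {m : ℕ} {s : Fin m → V} (hs : SpansSimplex K s) (i j k : Fin m) :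
    SpansSimplex K ![s i, s j, s k] :=
  hs.of_range_subset (by simp [Set.insert_subset_iff])

/-- A simplicial `1`-cocycle on `K`, as a function on pairs of vertices whose values away from the
edges of `K` are irrelevant. -/
def IsCocycle (K : PreAbstractSimplicialComplex V) (f : V → V → F) : Prop :=
  ∀ a b c, SpansSimplex K ![a, b, c] → f a b + f b c = f a c

theorem IsCocycle.mono (h : K ≤ L) {f : V → V → F} (hf : IsCocycle L f) : IsCocycle K f :=
  fun a b c habc => hf a b c (habc.mono h)

theorem IsCocycle.self {f : V → V → F} (hf : IsCocycle K f) {m : ℕ} {s : Fin m → V}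
    (hs : SpansSimplex K s) (i : Fin m) : f (s i) (s i) = 0 :=
  add_eq_left.mp (hf _ _ _ (hs.triple i i i))

theorem IsCocycle.symm {f : V → V → F} (hf : IsCocycle K f) {m : ℕ} {s : Fin m → V}
    (hs : SpansSimplex K s) (i j : Fin m) : f (s j) (s i) = -f (s i) (s j) :=
  eq_neg_of_add_eq_zero_right ((hf _ _ _ (hs.triple i j i)).trans (hf.self hs i))

/-- The value of a function on pairs of vertices on a `1`-chain, by linearity. -/
noncomputable def edgeEval (f : V → V → F) : ((Fin (1 + 1) → V) →₀ F) →ₗ[F] F :=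
  Finsupp.linearCombination F fun s : Fin (1 + 1) → V => f (s 0) (s 1)

@[simp]
theorem edgeEval_single (f : V → V → F) (s : Fin (1 + 1) → V) (c : F) :
    edgeEval f (Finsupp.single s c) = c * f (s 0) (s 1) := by
  simp [edgeEval]

theorem edgeEval_congr {f f' : V → V → F} (h : ∀ a b, SpansSimplex K ![a, b] → f a b = f' a b)
    {x : (Fin (1 + 1) → V) →₀ F} (hx : x ∈ tupleChains F K 1) : edgeEval f x = edgeEval f' x := by
  rw [edgeEval, edgeEval, Finsupp.linearCombination_apply, Finsupp.linearCombination_apply]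
  exact Finsupp.sum_congr fun s hs => by rw [h _ _ (SpansSimplex.pair (hx hs) 0 1)]

theorem eq_edgeEval (lam : ((Fin (1 + 1) → V) →₀ F) →ₗ[F] F) :
    lam = edgeEval fun a b => lam (Finsupp.single ![a, b] 1) := by
  refine Finsupp.lhom_ext fun s c => ?_
  have hs : s = ![s 0, s 1] := by
    ext i
    fin_cases i <;> rfl
  rw [edgeEval_single, ← hs, ← smul_eq_mul, ← map_smul, Finsupp.smul_single, smul_eq_mul, mul_one]

theorem simplicialBoundary_zero_single (s : Fin (0 + 1 + 1) → V) (c : F) :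
    simplicialBoundary F V 0 (Finsupp.single s c) =
      Finsupp.single ![s 1] c - Finsupp.single ![s 0] c := by
  have h₀ : s ∘ Fin.succ = ![s 1] := by ext i; fin_cases i; rfl
  have h₁ : s ∘ Fin.succAbove 1 = ![s 0] := by ext i; fin_cases i; rfl
  simp [simplicialBoundary, Fin.sum_univ_two, h₀, h₁, sub_eq_add_neg]

theorem simplicialBoundary_one_single (s : Fin (1 + 1 + 1) → V) (c : F) :
    simplicialBoundary F V 1 (Finsupp.single s c) =
      Finsupp.single ![s 1, s 2] c - Finsupp.single ![s 0, s 2] c +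
        Finsupp.single ![s 0, s 1] c := by
  have h₀ : s ∘ Fin.succ = ![s 1, s 2] := by ext i; fin_cases i <;> rfl
  have h₁ : s ∘ Fin.succAbove 1 = ![s 0, s 2] := by ext i; fin_cases i <;> rfl
  have h₂ : s ∘ Fin.succAbove 2 = ![s 0, s 1] := by ext i; fin_cases i <;> rfl
  simp [simplicialBoundary, Fin.sum_univ_three, h₀, h₁, h₂, sub_eq_add_neg]

theorem simplicialBoundary_zero_comp_one :
    (simplicialBoundary F V 0).comp (simplicialBoundary F V 1) = 0 := by
  refine Finsupp.lhom_ext fun s c => ?_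
  simp [simplicialBoundary_one_single, simplicialBoundary_zero_single]

theorem edgeEval_boundary_single (f : V → V → F) (s : Fin (1 + 1 + 1) → V) (c : F) :
    edgeEval f (simplicialBoundary F V 1 (Finsupp.single s c)) =
      c * (f (s 0) (s 1) + f (s 1) (s 2) - f (s 0) (s 2)) := by
  simp only [simplicialBoundary_one_single, map_add, map_sub, edgeEval_single, Matrix.cons_val]
  ring

theorem orientationRel_zero (K : PreAbstractSimplicialComplex V) : orientationRel F K 0 = ⊥ := by
  have : Subsingleton (Fin (0 + 1)) := inferInstanceAs (Subsingleton (Fin 1))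
  rw [orientationRel, Submodule.span_eq_bot]
  rintro x (⟨s, -, hs, -⟩ | ⟨s, π, -, rfl⟩)
  · exact absurd (Function.injective_of_subsingleton s) hs
  · rw [Subsingleton.elim π 1]
    simp

theorem mem_simplicialCycles_one_iff {x : (Fin (1 + 1) → V) →₀ F} :
    x ∈ simplicialCycles F K 1 ↔ x ∈ tupleChains F K 1 ∧ simplicialBoundary F V 0 x = 0 := by
  rw [simplicialCycles, Submodule.mem_inf, Submodule.mem_comap, orientationRel_zero,
    Submodule.mem_bot]

theorem edgeEval_coboundary (g : V → F) {x : (Fin (1 + 1) → V) →₀ F}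
    (hx : x ∈ simplicialCycles F K 1) : edgeEval (fun a b => g b - g a) x = 0 := by
  have hcomp : edgeEval (fun a b => g b - g a) =
      (Finsupp.linearCombination F fun s : Fin (0 + 1) → V => g (s 0)).comp
        (simplicialBoundary F V 0) := by
    refine Finsupp.lhom_ext fun s c => ?_
    simp [simplicialBoundary_zero_single, mul_sub]
  rw [hcomp, LinearMap.comp_apply, (mem_simplicialCycles_one_iff.mp hx).2, map_zero]

theorem IsCocycle.edgeEval_eq_zero_of_mem_orientationRel {f : V → V → F} (hf : IsCocycle K f)
    {x : (Fin (1 + 1) → V) →₀ F} (hx : x ∈ orientationRel F K 1) : edgeEval f x = 0 := by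
  suffices orientationRel F K 1 ≤ LinearMap.ker (edgeEval f) from this hx
  refine Submodule.span_le.mpr ?_
  rintro _ (⟨s, hs, hinj, rfl⟩ | ⟨s, π, hs, rfl⟩) <;> rw [SetLike.mem_coe, LinearMap.mem_ker]
  · have h01 : s 0 = s 1 := by
      by_contra h
      refine hinj fun i j hij => ?_
      fin_cases i <;> fin_cases j <;> simp_all
    rw [edgeEval_single, ← h01, hf.self hs, mul_zero]
  · obtain rfl | rfl : π = 1 ∨ π = Equiv.swap 0 1 := by
      revert π
      decide
    · simp
    · simp [hf.symm hs 0 1]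

theorem IsCocycle.edgeEval_eq_zero_of_mem_simplicialBoundaries {f : V → V → F}
    (hf : IsCocycle K f) {x : (Fin (1 + 1) → V) →₀ F} (hx : x ∈ simplicialBoundaries F K 1) :
    edgeEval f x = 0 := by
  suffices simplicialBoundaries F K 1 ≤ LinearMap.ker (edgeEval f) from this hx
  refine sup_le ?_ fun _ => hf.edgeEval_eq_zero_of_mem_orientationRel
  rw [Submodule.map_le_iff_le_comap, tupleChains, Finsupp.supported_eq_span_single,
    Submodule.span_le]
  rintro _ ⟨s, hs, rfl⟩
  rw [SetLike.mem_coe, Submodule.mem_comap, LinearMap.mem_ker, edgeEval_boundary_single,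
    hf _ _ _ (SpansSimplex.triple hs 0 1 2), sub_self, mul_zero]

open Classical in
/-- The linear form on first homology given by a cocycle (zero if `f` is not a cocycle). -/
noncomputable def cocycleEval (K : PreAbstractSimplicialComplex V) (f : V → V → F) :
    SimplicialHomology F K 1 →ₗ[F] F :=
  if hf : IsCocycle K f then
    Submodule.liftQ _ ((edgeEval f).comp (simplicialCycles F K 1).subtype)
      fun _ hx => hf.edgeEval_eq_zero_of_mem_simplicialBoundaries hx
  else 0

theorem IsCocycle.cocycleEval_mk {f : V → V → F} (hf : IsCocycle K f)
    (x : simplicialCycles F K 1) :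
    cocycleEval K f (Submodule.Quotient.mk x) = edgeEval f x.1 := by
  rw [cocycleEval, dif_pos hf]
  rfl

theorem IsCocycle.cocycleEval_map {f : V → V → F} (hf : IsCocycle L f) (h : K ≤ L)
    (x : SimplicialHomology F K 1) :
    cocycleEval L f (simplicialHomologyMap F h 1 x) = cocycleEval K f x := by
  obtain ⟨x, rfl⟩ := Submodule.Quotient.mk_surjective _ x
  rw [(hf.mono h).cocycleEval_mk]
  exact hf.cocycleEval_mk _

theorem IsCocycle.cocycleEval_eq_zero {f : V → V → F} (hf : IsCocycle K f)
    (hzero : ∀ a b, SpansSimplex K ![a, b] → f a b = 0) : cocycleEval K f = 0 := by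
  refine LinearMap.ext fun x => ?_
  obtain ⟨x, rfl⟩ := Submodule.Quotient.mk_surjective _ x
  rw [hf.cocycleEval_mk, edgeEval_congr (f' := 0) hzero x.2.1]
  simp [edgeEval, Finsupp.linearCombination_apply]

theorem boundary_single_mem_simplicialCycles {s : Fin (1 + 1 + 1) → V} (hs : SpansSimplex K s) :
    simplicialBoundary F V 1 (Finsupp.single s 1) ∈ simplicialCycles F K 1 := by
  refine mem_simplicialCycles_one_iff.mpr
    ⟨?_, LinearMap.congr_fun simplicialBoundary_zero_comp_one _⟩
  have hmem : ∀ i j, Finsupp.single ![s i, s j] (1 : F) ∈ tupleChains F K 1 := fun i j =>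
    Finsupp.single_mem_supported F _ (hs.pair i j)
  rw [simplicialBoundary_one_single]
  exact add_mem (sub_mem (hmem 1 2) (hmem 0 2)) (hmem 0 1)

theorem exists_isCocycle_cocycleEval_eq (lam : SimplicialHomology F K 1 →ₗ[F] F) :
    ∃ f, IsCocycle K f ∧ cocycleEval K f = lam := by
  obtain ⟨lam', hlam'⟩ := (lam.comp (Submodule.mkQ _)).exists_extend
  have hext : ∀ y : simplicialCycles F K 1, lam (Submodule.Quotient.mk y) = lam' y.1 := fun y =>
    (LinearMap.congr_fun hlam' y).symm
  have hcocycle : IsCocycle K fun a b => lam' (Finsupp.single ![a, b] 1) := by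
    intro a b c habc
    have hcycle := boundary_single_mem_simplicialCycles (F := F) habc
    have hzero : (Submodule.Quotient.mk ⟨_, hcycle⟩ : SimplicialHomology F K 1) = 0 :=
      (Submodule.Quotient.mk_eq_zero _).mpr
        (Submodule.mem_sup_left ⟨_, Finsupp.single_mem_supported F _ habc, rfl⟩)
    have hlam := hext ⟨_, hcycle⟩
    rw [hzero, map_zero, eq_edgeEval lam', edgeEval_boundary_single, one_mul] at hlam
    exact sub_eq_zero.mp hlam.symm
  refine ⟨_, hcocycle, LinearMap.ext fun x => ?_⟩
  obtain ⟨x, rfl⟩ := Submodule.Quotient.mk_surjective _ x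
  rw [hcocycle.cocycleEval_mk, ← eq_edgeEval, hext]

theorem IsCocycle.cocycleEval_eq_of_cohomologous {f f' : V → V → F} (hf : IsCocycle K f)
    (hf' : IsCocycle K f') (h : Cohomologous (fun a b => SpansSimplex K ![a, b]) f f') :
    cocycleEval K f = cocycleEval K f' := by
  obtain ⟨g, hg⟩ := h
  refine LinearMap.ext fun x => ?_
  obtain ⟨x, rfl⟩ := Submodule.Quotient.mk_surjective _ x
  have hsplit : edgeEval (fun a b => f' a b + (g b - g a)) =
      edgeEval f' + edgeEval (fun a b => g b - g a) := by
    refine Finsupp.lhom_ext fun s c => ?_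
    simp [mul_add]
  rw [hf.cocycleEval_mk, hf'.cocycleEval_mk, edgeEval_congr hg x.2.1, hsplit, LinearMap.add_apply,
    edgeEval_coboundary g x.2, add_zero]

variable {ι : Type*} [Fintype ι] {θ : ι → V → V → F}

theorem IsCocycle.sum_mul (hθ : ∀ i, IsCocycle K (θ i)) (c : ι → F) :
    IsCocycle K fun a b => ∑ i, c i * θ i a b := fun x y z h => by
  simp only [← Finset.sum_add_distrib, ← mul_add, hθ _ x y z h]

theorem IsCocycle.cocycleEval_sum_mul (hθ : ∀ i, IsCocycle K (θ i)) (c : ι → F)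
    (x : SimplicialHomology F K 1) :
    cocycleEval K (fun a b => ∑ i, c i * θ i a b) x = ∑ i, c i * cocycleEval K (θ i) x := by
  obtain ⟨x, rfl⟩ := Submodule.Quotient.mk_surjective _ x
  have hsum : edgeEval (fun a b => ∑ i, c i * θ i a b) = ∑ i, c i • edgeEval (θ i) := by
    refine Finsupp.lhom_ext fun s d => ?_
    simp [LinearMap.sum_apply, Finset.mul_sum, mul_left_comm]
  simp [(sum_mul hθ c).cocycleEval_mk, (hθ _).cocycleEval_mk, hsum, LinearMap.sum_apply]

theorem eq_zero_of_cocycleEval_eq_zero (hθ : ∀ i, IsCocycle K (θ i))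
    (hspan : ∀ f : V → V → F, IsCocycle K f → ∃ c : ι → F,
      Cohomologous (fun a b => SpansSimplex K ![a, b]) f fun a b => ∑ i, c i * θ i a b)
    {x : SimplicialHomology F K 1} (hx : ∀ i, cocycleEval K (θ i) x = 0) : x = 0 := by
  refine (Module.forall_dual_apply_eq_zero_iff F _).mp fun lam => ?_
  obtain ⟨f, hf, rfl⟩ := exists_isCocycle_cocycleEval_eq lam
  obtain ⟨c, hc⟩ := hspan f hf
  rw [hf.cocycleEval_eq_of_cohomologous (IsCocycle.sum_mul hθ c) hc,
    IsCocycle.cocycleEval_sum_mul hθ]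
  exact Finset.sum_eq_zero fun i _ => by rw [hx, mul_zero]

theorem exists_forall_cocycleEval_eq_sum {m : ℕ} [NeZero m] (s : Fin m → V)
    (hs : ∀ q, SpansSimplex K ![s q, s (q + 1)]) :
    ∃ x : SimplicialHomology F K 1, ∀ f, IsCocycle K f →
      cocycleEval K f x = ∑ q, f (s q) (s (q + 1)) := by
  have hcycle : ∑ q, Finsupp.single ![s q, s (q + 1)] (1 : F) ∈ simplicialCycles F K 1 := by
    refine mem_simplicialCycles_one_iff.mpr
      ⟨Submodule.sum_mem _ fun q _ => Finsupp.single_mem_supported F _ (hs q), ?_⟩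
    have hshift : ∑ q, Finsupp.single ![s (q + 1)] (1 : F) = ∑ q, Finsupp.single ![s q] 1 :=
      Equiv.sum_comp (Equiv.addRight (1 : Fin m)) fun q => Finsupp.single ![s q] (1 : F)
    simp [simplicialBoundary_zero_single, Finset.sum_sub_distrib, hshift]
  refine ⟨Submodule.Quotient.mk ⟨_, hcycle⟩, fun f hf => ?_⟩
  simp [hf.cocycleEval_mk]

end Cocycles

/-! ### Cocycles on flag complexes -/

section FlagCocycles

variable {W W' A : Type*} [AddCommGroup A] {R : W → W → Prop} {S : W' → W' → Prop}
  {f f' f'' : W → W → A}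

theorem Cohomologous.trans (h : Cohomologous R f f') (h' : Cohomologous R f' f'') :
    Cohomologous R f f'' := by
  obtain ⟨g, hg⟩ := h
  obtain ⟨g', hg'⟩ := h'
  refine ⟨g + g', fun a b hab => ?_⟩
  rw [hg a b hab, hg' a b hab, Pi.add_apply, Pi.add_apply]
  abel

/-- A simplicial `1`-cocycle on the flag complex of the graph with adjacency relation `R`. -/
def IsFlagCocycle (R : W → W → Prop) (f : W → W → A) : Prop :=
  ∀ u v w, R u v → R v w → R u w → f u v + f v w = f u w

namespace IsFlagCocycle

theorem comp (hf : IsFlagCocycle R f) {φ : W' → W} (hφ : ∀ a b, S a b → R (φ a) (φ b)) :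
    IsFlagCocycle S fun a b => f (φ a) (φ b) :=
  fun _ _ _ huv hvw huw => hf _ _ _ (hφ _ _ huv) (hφ _ _ hvw) (hφ _ _ huw)

theorem self (hf : IsFlagCocycle R f) {u : W} (hu : R u u) : f u u = 0 :=
  add_eq_left.mp (hf u u u hu hu hu)

theorem symm (hf : IsFlagCocycle R f) {u v : W} (hu : R u u) (huv : R u v) (hvu : R v u) :
    f v u = -f u v :=
  eq_neg_of_add_eq_zero_right ((hf u v u huv hvu hu).trans (hf.self hu))

theorem cohomologous_of_contiguous (hf : IsFlagCocycle R f) {φ ψ : W' → W}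
    (hS : ∀ a b, S a b → S a a ∧ S b b) (hφ : ∀ a b, S a b → R (φ a) (φ b))
    (hψ : ∀ a b, S a b → R (ψ a) (ψ b)) (hφψ : ∀ a b, S a b → R (φ a) (ψ b)) :
    Cohomologous S (fun a b => f (φ a) (φ b)) fun a b => f (ψ a) (ψ b) := by
  refine ⟨fun a => -f (φ a) (ψ a), fun a b hab => ?_⟩
  obtain ⟨haa, hbb⟩ := hS a b hab
  have hlower := hf _ _ _ (hφ a b hab) (hφψ b b hbb) (hφψ a b hab)
  have hupper := hf _ _ _ (hφψ a a haa) (hψ a b hab) (hφψ a b hab)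
  beta_reduce
  rw [eq_sub_of_add_eq (hlower.trans hupper.symm)]
  abel

theorem cohomologous_of_dominated (hf : IsFlagCocycle R f) (hrefl : ∀ u v, R u v → R u u)
    (hsymm : ∀ u v, R u v → R v u) {r : W → W} (hr : ∀ u v, R u v → R u (r v)) :
    Cohomologous R f fun u v => f (r u) (r v) :=
  hf.cohomologous_of_contiguous (φ := id)
    (fun u v h => ⟨hrefl u v h, hrefl v u (hsymm u v h)⟩) (fun _ _ h => h)
    (fun u v h => hr _ _ (hsymm _ _ (hr _ _ (hsymm u v h)))) hr

end IsFlagCocycle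

end FlagCocycles

/-! ### The combinatorics of the witness -/

section WitnessGraph

/-- The cocycle of the `4`-cycle of directions that is `1` on the edge from `0` to `1`. -/
def squareCocycle (F : Type*) [Field F] (q q' : Fin 4) : F :=
  if q = 0 ∧ q' = 1 then 1 else if q = 1 ∧ q' = 0 then -1 else 0

variable {F : Type*} [Field F]

theorem squareCocycle_self (q : Fin 4) : squareCocycle F q q = 0 := by
  fin_cases q <;> simp [squareCocycle]

theorem isFlagCocycle_squareCocycle :
    IsFlagCocycle (fun q q' : Fin 4 => q' ≠ q + 2) (squareCocycle F) := by
  intro q q' q''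
  fin_cases q <;> fin_cases q' <;> fin_cases q'' <;> simp [squareCocycle]

theorem sum_squareCocycle : ∑ q : Fin 4, squareCocycle F q (q + 1) = 1 := by
  simp [Fin.sum_univ_four, squareCocycle]

theorem exists_cohomologous_mul_squareCocycle {R : Fin 4 → Fin 4 → Prop} {h : Fin 4 → Fin 4 → F}
    (hh : IsFlagCocycle R h) (hrefl : ∀ q q', R q q' → R q q) (hsymm : ∀ q q', R q q' → R q' q)
    (hR : ∀ q q', R q q' → q' ≠ q + 2) :
    ∃ c : F, Cohomologous R h fun q q' => c * squareCocycle F q q' := by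
  -- The potential accounts for all edges but `01`, which the holonomy of the square corrects.
  refine ⟨h 0 1 - h 0 3 - h 3 2 - h 2 1, ![0, h 0 3 + h 3 2 + h 2 1, h 0 3 + h 3 2, h 0 3],
    fun q q' hqq' => ?_⟩
  have hself : h q q = 0 := hh.self (hrefl _ _ hqq')
  have hswap : h q' q = -h q q' := hh.symm (hrefl _ _ hqq') hqq' (hsymm _ _ hqq')
  have hadj := hR q q' hqq'
  clear hqq'
  fin_cases q <;> fin_cases q' <;>
    first
    | exact absurd rfl hadj
    | simp only [squareCocycle, Fin.reduceFinMk, Fin.zero_eta, Fin.mk_one, Fin.isValue,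
        Fin.reduceEq, zero_ne_one, one_ne_zero, and_self, and_true, and_false, if_true,
        if_false, Matrix.cons_val] at hself hswap ⊢
      first
      | ring1
      | linear_combination hself
      | linear_combination hswap

/-- Labels of the points of the witness: a layer, a direction, and a slot, which is `none` for the
point of the inner square and `some j` for the points of the outer cluster. -/
abbrev WitnessIndex (n : ℕ) : Type := Fin (n + 1) × Fin 4 × Option (Fin (n + 1))

/-- The index of the scale at which the `j`-th point of a cluster in layer `i` gets attached to
the inner square. -/
def attachIndex (i j : ℕ) : ℕ := if j = i then i + 1 else j

variable {n s : ℕ}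

theorem attachIndex_le (i : ℕ) (j : Fin (n + 1)) : attachIndex i j ≤ n + 1 := by
  have := j.2
  unfold attachIndex
  split_ifs <;> omega

theorem attachIndex_zero_le (i j : ℕ) : attachIndex i 0 ≤ attachIndex i j := by
  unfold attachIndex
  split_ifs <;> omega

/-- Adjacency of slots at the scale with index `s`, for points in the layers `i` and `i'` and in
the directions `q` and `q'`. -/
def SlotAdj (s : ℕ) (i i' : Fin (n + 1)) (q q' : Fin 4) :
    Option (Fin (n + 1)) → Option (Fin (n + 1)) → Prop
  | none, none => q' ≠ q + 2
  | none, some j => q = q' ∧ attachIndex i' j ≤ s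
  | some j, none => q = q' ∧ attachIndex i j ≤ s
  | some _, some _ => q = q'

/-- Adjacency of layers at the scale with index `s`. -/
def LayerAdj (s : ℕ) (i i' : Fin (n + 1)) : Prop :=
  i = i' ∨ (s = n + 1 ∧ ((i : ℕ) + 1 = i' ∨ (i' : ℕ) + 1 = i))

/-- Adjacency (or equality) of points of the witness at the scale with index `s`. -/
def WitnessAdj (s : ℕ) (u v : WitnessIndex n) : Prop :=
  LayerAdj s u.1 v.1 ∧ SlotAdj s u.1 v.1 u.2.1 v.2.1 u.2.2 v.2.2

theorem ne_add_two (q : Fin 4) : q ≠ q + 2 := by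
  revert q
  decide

theorem ne_add_two_symm {q q' : Fin 4} : q' ≠ q + 2 → q ≠ q' + 2 := by
  revert q q'
  decide

theorem LayerAdj.symm {i i' : Fin (n + 1)} (h : LayerAdj s i i') : LayerAdj s i' i :=
  h.imp Eq.symm (And.imp_right Or.symm)

theorem LayerAdj.eq {i i' : Fin (n + 1)} (h : LayerAdj s i i') (hs : s ≤ n) : i = i' :=
  h.resolve_right fun h' => by omega

theorem witnessAdj_refl (u : WitnessIndex n) : WitnessAdj s u u := by
  refine ⟨Or.inl rfl, ?_⟩
  obtain ⟨i, q, _ | j⟩ := u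
  · exact ne_add_two q
  · exact rfl

theorem WitnessAdj.symm {u v : WitnessIndex n} (h : WitnessAdj s u v) : WitnessAdj s v u := by
  refine ⟨h.1.symm, ?_⟩
  obtain ⟨i, q, _ | j⟩ := u <;> obtain ⟨i', q', _ | j'⟩ := v <;> obtain ⟨-, hslot⟩ := h
  · exact ne_add_two_symm hslot
  · exact ⟨hslot.1.symm, hslot.2⟩
  · exact ⟨hslot.1.symm, hslot.2⟩
  · exact Eq.symm hslot

theorem SlotAdj.dir_ne {i i' : Fin (n + 1)} {q q' : Fin 4} {m m' : Option (Fin (n + 1))}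
    (h : SlotAdj s i i' q q' m m') : q' ≠ q + 2 := by
  rcases m with _ | j <;> rcases m' with _ | j'
  · exact h
  · exact h.1 ▸ ne_add_two q
  · exact h.1 ▸ ne_add_two q
  · exact (show q = q' from h) ▸ ne_add_two q

theorem SlotAdj.dir_eq {i i' : Fin (n + 1)} {q q' : Fin 4} {j : Fin (n + 1)}
    {m' : Option (Fin (n + 1))} (h : SlotAdj s i i' q q' (some j) m') : q = q' := by
  rcases m' with _ | j'
  exacts [h.1, h]

/-- The degree condition on a point of the witness at the point `p` of the subgrid, where a point
counts as a neighbour of itself. -/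
def WitnessPresent (p : Fin (n + 2) × Fin (n + 2)) (u : WitnessIndex n) : Prop :=
  n + 4 ≤ {v | WitnessAdj p.2 u v}.ncard + p.1

/-- Adjacency in the degree-Rips complex of the witness at the point `p` of the subgrid. -/
def WitnessEdge (p : Fin (n + 2) × Fin (n + 2)) (u v : WitnessIndex n) : Prop :=
  WitnessAdj p.2 u v ∧ WitnessPresent p u ∧ WitnessPresent p v

variable {p : Fin (n + 2) × Fin (n + 2)} {u v : WitnessIndex n}

theorem WitnessEdge.refl (h : WitnessEdge p u v) : WitnessEdge p u u :=
  ⟨witnessAdj_refl u, h.2.1, h.2.1⟩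

theorem WitnessEdge.symm (h : WitnessEdge p u v) : WitnessEdge p v u :=
  ⟨h.1.symm, h.2.symm⟩

theorem WitnessEdge.comp_of_dominated {r : WitnessIndex n → WitnessIndex n}
    (hr : ∀ u v, WitnessAdj p.2 u v → WitnessAdj p.2 u (r v)) (h : WitnessEdge p u v) :
    WitnessEdge p u (r v) := by
  refine ⟨hr u v h.1, h.2.1, h.2.2.trans (Nat.add_le_add_right ?_ _)⟩
  exact Set.ncard_le_ncard fun w hw => (hr w v hw.symm).symm

theorem IsFlagCocycle.cohomologous_of_forall_witnessAdj {f : WitnessIndex n → WitnessIndex n → F}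
    (hf : IsFlagCocycle (WitnessEdge p) f) {r : WitnessIndex n → WitnessIndex n}
    (hr : ∀ u v, WitnessAdj p.2 u v → WitnessAdj p.2 u (r v)) :
    Cohomologous (WitnessEdge p) f fun u v => f (r u) (r v) :=
  hf.cohomologous_of_dominated (fun _ _ => WitnessEdge.refl) (fun _ _ => WitnessEdge.symm)
    fun _ _ => WitnessEdge.comp_of_dominated hr

/-- Collapses each outer cluster onto its first point, which attaches first to the inner square. -/
def collapseClusters (u : WitnessIndex n) : WitnessIndex n :=
  (u.1, u.2.1, u.2.2.map fun _ => 0)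

theorem WitnessAdj.to_collapseClusters {u v : WitnessIndex n} (h : WitnessAdj s u v) :
    WitnessAdj s u (collapseClusters v) := by
  obtain ⟨i, q, m⟩ := u
  obtain ⟨i', q', _ | j'⟩ := v
  · exact h
  · refine ⟨h.1, ?_⟩
    rcases m with _ | j
    · exact ⟨h.2.1, (attachIndex_zero_le i' j').trans h.2.2⟩
    · exact h.2

theorem WitnessEdge.collapseClusters_collapseClusters (h : WitnessEdge p u v) :
    WitnessEdge p (collapseClusters u) (collapseClusters v) :=
  have hr {u v : WitnessIndex n} : WitnessEdge p u v → WitnessEdge p u (collapseClusters v) :=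
    WitnessEdge.comp_of_dominated fun _ _ => WitnessAdj.to_collapseClusters
  hr (hr h.symm).symm

theorem IsFlagCocycle.exists_cohomologous_of_le (hp : (p.2 : ℕ) ≤ n)
    {f : WitnessIndex n → WitnessIndex n → F} (hf : IsFlagCocycle (WitnessEdge p) f) :
    ∃ c : Fin (n + 1) → F,
      Cohomologous (WitnessEdge p) f fun u v => c u.1 * squareCocycle F u.2.1 v.2.1 := by
  have hsquare : ∀ i, ∃ c : F, Cohomologous (fun q q' => WitnessEdge p (i, q, none) (i, q', none))
      (fun q q' => f (i, q, none) (i, q', none)) fun q q' => c * squareCocycle F q q' := fun i =>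
    exists_cohomologous_mul_squareCocycle (hf.comp fun _ _ h => h)
      (fun _ _ => WitnessEdge.refl) (fun _ _ => WitnessEdge.symm) fun _ _ h => h.1.2
  choose c P hP using hsquare
  let g : WitnessIndex n → F := fun u =>
    P u.1 u.2.1 + u.2.2.elim 0 fun _ => f (u.1, u.2.1, none) (u.1, u.2.1, some 0)
  refine ⟨c, (hf.cohomologous_of_forall_witnessAdj fun _ _ => WitnessAdj.to_collapseClusters).trans
    ⟨g, fun u v huv => ?_⟩⟩
  replace huv := huv.collapseClusters_collapseClusters
  obtain ⟨i, q, m⟩ := u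
  obtain ⟨i', q', m'⟩ := v
  obtain rfl : i = i' := huv.1.1.eq hp
  rcases m with _ | j <;> rcases m' with _ | j'
  · simpa [g, collapseClusters] using hP i q q' huv
  · obtain rfl : q = q' := huv.1.2.1
    simp [g, collapseClusters, squareCocycle_self]
  · obtain rfl : q = q' := huv.1.2.1
    simpa [g, collapseClusters, squareCocycle_self] using hf.symm huv.symm.refl huv.symm huv
  · obtain rfl : q = q' := huv.1.2
    simpa [g, collapseClusters, squareCocycle_self] using hf.self huv.refl

/-- Projects the witness to the inner squares and moves the layers above the `k`-th one to the
`k`-th layer. -/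
def collapseLayers (k : Fin (n + 1)) (u : WitnessIndex n) : WitnessIndex n :=
  (min u.1 k, u.2.1, none)

theorem WitnessAdj.to_collapseLayers_last (h : WitnessAdj (n + 1) u v) :
    WitnessAdj (n + 1) u (collapseLayers (Fin.last n) v) := by
  refine ⟨?_, ?_⟩
  · rw [collapseLayers, min_eq_left (Fin.le_last v.1)]
    exact h.1
  obtain ⟨i, q, _ | j⟩ := u
  · exact h.2.dir_ne
  · exact ⟨h.2.dir_eq, attachIndex_le _ _⟩

theorem LayerAdj.min_min {i i' k k' : Fin (n + 1)} (h : LayerAdj (n + 1) i i')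
    (hk : (k : ℕ) ≤ k') (hk' : (k' : ℕ) ≤ k + 1) :
    LayerAdj (n + 1) (min i k') (min i' k) := by
  simp only [LayerAdj, Fin.ext_iff, Fin.coe_min, true_and] at h ⊢
  omega

theorem WitnessEdge.collapseLayers_collapseLayers (hp : (p.2 : ℕ) = n + 1)
    (hpres : ∀ i q, WitnessPresent p (i, q, none)) {k k' : Fin (n + 1)} (hk : (k : ℕ) ≤ k')
    (hk' : (k' : ℕ) ≤ k + 1) (h : WitnessEdge p u v) :
    WitnessEdge p (collapseLayers k' u) (collapseLayers k v) := by
  refine ⟨⟨?_, h.1.2.dir_ne⟩, hpres _ _, hpres _ _⟩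
  have hlayer := h.1.1
  rw [hp] at hlayer ⊢
  exact hlayer.min_min hk hk'

theorem IsFlagCocycle.exists_cohomologous_of_eq (hp : (p.2 : ℕ) = n + 1)
    (hpres : ∀ i q, WitnessPresent p (i, q, none)) {f : WitnessIndex n → WitnessIndex n → F}
    (hf : IsFlagCocycle (WitnessEdge p) f) :
    ∃ c : F, Cohomologous (WitnessEdge p) f fun u v => c * squareCocycle F u.2.1 v.2.1 := by
  have hcollapse (k : Fin (n + 1)) :
      Cohomologous (WitnessEdge p) f fun u v => f (collapseLayers k u) (collapseLayers k v) := by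
    induction k using Fin.reverseInduction with
    | last =>
      refine hf.cohomologous_of_forall_witnessAdj fun _ _ => ?_
      rw [hp]
      exact WitnessAdj.to_collapseLayers_last
    | cast k ih =>
      refine ih.trans (hf.cohomologous_of_contiguous (fun _ _ h => ⟨h.refl, h.symm.refl⟩) ?_ ?_ ?_)
      · exact fun _ _ => WitnessEdge.collapseLayers_collapseLayers hp hpres le_rfl (by simp)
      · exact fun _ _ => WitnessEdge.collapseLayers_collapseLayers hp hpres le_rfl (by simp)
      · exact fun _ _ => WitnessEdge.collapseLayers_collapseLayers hp hpres (by simp) (by simp)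
  obtain ⟨c, P, hP⟩ := exists_cohomologous_mul_squareCocycle (R := fun q q' => q' ≠ q + 2)
    (hf.comp (φ := fun q => (0, q, none)) fun _ _ h => ⟨⟨Or.inl rfl, h⟩, hpres _ _, hpres _ _⟩)
    (fun q _ _ => ne_add_two q)
    (fun _ _ => ne_add_two_symm) fun _ _ h => h
  refine ⟨c, (hcollapse 0).trans ⟨fun u => P u.2.1, fun u v huv => ?_⟩⟩
  simpa [collapseLayers] using hP _ _ huv.1.2.dir_ne

end WitnessGraph

/-! ### The geometry of the witness -/

section WitnessGeometry

/-- The point with radial component `t` in direction `q`, tangential component `τ` and height `z`.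
It treats the directions `A` and `B` of the witness on the same footing. -/
def dirPoint (q : Fin 4) (t τ z : ℝ) : Fin 3 → ℝ :=
  (![![t, τ, z], ![-τ, t, z], ![-t, -τ, z], ![τ, -t, z]] : Fin 4 → Fin 3 → ℝ) q

variable {t t' τ τ' z z' r : ℝ}

theorem dist_vec_three_le_iff {x y z x' y' z' : ℝ} (hr : 0 ≤ r) :
    dist ![x, y, z] ![x', y', z'] ≤ r ↔ |x - x'| ≤ r ∧ |y - y'| ≤ r ∧ |z - z'| ≤ r := by
  rw [dist_pi_le_iff hr]
  simp [Fin.forall_fin_succ, Real.dist_eq]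

theorem dist_dirPoint_same_le_iff (hr : 0 ≤ r) (q : Fin 4) :
    dist (dirPoint q t τ z) (dirPoint q t' τ' z') ≤ r ↔
      |z - z'| ≤ r ∧ |t - t'| ≤ r ∧ |τ - τ'| ≤ r := by
  fin_cases q <;> refine (dist_vec_three_le_iff hr).trans ?_ <;> simp only [abs_le] <;> grind

theorem dist_dirPoint_next_le_iff (hr : 0 ≤ r) (q : Fin 4) :
    dist (dirPoint q t τ z) (dirPoint (q + 1) t' τ' z') ≤ r ↔
      |z - z'| ≤ r ∧ |t + τ'| ≤ r ∧ |t' - τ| ≤ r := by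
  fin_cases q <;> refine (dist_vec_three_le_iff hr).trans ?_ <;> simp only [abs_le] <;> grind

theorem dist_dirPoint_opposite_le_iff (hr : 0 ≤ r) (q : Fin 4) :
    dist (dirPoint q t τ z) (dirPoint (q + 2) t' τ' z') ≤ r ↔
      |z - z'| ≤ r ∧ |t + t'| ≤ r ∧ |τ + τ'| ≤ r := by
  fin_cases q <;> refine (dist_vec_three_le_iff hr).trans ?_ <;> simp only [abs_le] <;> grind

theorem dirPoint_inj {q q' : Fin 4} (hτ : 0 ≤ τ) (hτt : τ < t) (hτ' : 0 ≤ τ') (hτt' : τ' < t') :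
    dirPoint q t τ z = dirPoint q' t' τ' z' ↔ q = q' ∧ t = t' ∧ τ = τ' ∧ z = z' := by
  fin_cases q <;> fin_cases q' <;> simp [dirPoint] <;> grind

theorem spacePoint_dirA (t z : ℝ) (q : Fin 4) : spacePoint t (dirA q) z = dirPoint q t 0 z := by
  fin_cases q <;> simp [spacePoint, dirA, dirPoint]

theorem spacePoint_dirB (t ε z : ℝ) (q : Fin 4) :
    spacePoint t (dirB ε q) z = dirPoint q t (t * ε) z := by
  fin_cases q <;> simp [spacePoint, dirB, dirPoint]

variable {n : ℕ}

/-- The radial component of a point of the witness. -/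
noncomputable def witnessRadius (i : Fin (n + 1)) : Option (Fin (n + 1)) → ℝ
  | none => scaleB n 0
  | some j => scaleB n 0 + scaleB n (attachIndex i j)

/-- The tangential component of a point of the witness. -/
noncomputable def witnessTilt (i : Fin (n + 1)) : Option (Fin (n + 1)) → ℝ
  | none => 0
  | some j => if j = i then (scaleB n 0 + scaleB n (i + 1)) * (1 / (n : ℝ) ^ 2) else 0

/-- The point of the witness with a given label. -/
noncomputable def witnessPoint (u : WitnessIndex n) : Fin 3 → ℝ :=
  dirPoint u.2.1 (witnessRadius u.1 u.2.2) (witnessTilt u.1 u.2.2)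
    ((n + 1 / (n : ℝ) ^ 2) * (u.1 : ℕ))

theorem mem_witnessSet_iff {x : Fin 3 → ℝ} :
    x ∈ witnessSet n ↔ ∃ u : WitnessIndex n, witnessPoint u = x := by
  simp only [witnessSet, Finset.mem_biUnion, Finset.mem_range, Finset.mem_union, Finset.mem_image,
    Finset.mem_univ, true_and, Finset.mem_erase, spacePoint_dirA, spacePoint_dirB]
  constructor
  · rintro ⟨i, hi, (⟨q, rfl⟩ | ⟨j, ⟨hji, hj⟩, q, rfl⟩) | ⟨q, rfl⟩⟩
    · exact ⟨(⟨i, hi⟩, q, none), rfl⟩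
    · refine ⟨(⟨i, hi⟩, q, some ⟨j, hj⟩), ?_⟩
      simp [witnessPoint, witnessRadius, witnessTilt, attachIndex, hji]
    · refine ⟨(⟨i, hi⟩, q, some ⟨i, hi⟩), ?_⟩
      simp [witnessPoint, witnessRadius, witnessTilt, attachIndex]
  · rintro ⟨⟨i, q, _ | j⟩, rfl⟩
    · exact ⟨i, i.2, Or.inl (Or.inl ⟨q, rfl⟩)⟩
    · rcases eq_or_ne j i with rfl | hji
      · refine ⟨j, j.2, Or.inr ⟨q, ?_⟩⟩
        simp [witnessPoint, witnessRadius, witnessTilt, attachIndex]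
      · have hji' : (j : ℕ) ≠ i := Fin.val_ne_of_ne hji
        refine ⟨i, i.2, Or.inl (Or.inr ⟨j, ⟨hji', j.2⟩, q, ?_⟩)⟩
        simp [witnessPoint, witnessRadius, witnessTilt, attachIndex, hji, hji']

theorem scaleB_eq (n j : ℕ) :
    scaleB n j = n - n * (1 / (n : ℝ) ^ 2) + j * (1 / (n : ℝ) ^ 2) := by
  unfold scaleB
  ring

theorem scaleB_succ_self (n : ℕ) : scaleB n (n + 1) = n + 1 / (n : ℝ) ^ 2 := by
  rw [scaleB_eq]
  push_cast
  ring

theorem one_div_sq_pos (hn : 2 ≤ n) : 0 < 1 / (n : ℝ) ^ 2 := by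
  positivity

theorem mul_one_div_sq_le_half (hn : 2 ≤ n) : n * (1 / (n : ℝ) ^ 2) ≤ 1 / 2 := by
  have hn' : (2 : ℝ) ≤ n := by exact_mod_cast hn
  rw [mul_one_div, div_le_div_iff₀ (by positivity) (by norm_num)]
  nlinarith

theorem scaleB_le_scaleB_iff (hn : 2 ≤ n) {i j : ℕ} : scaleB n i ≤ scaleB n j ↔ i ≤ j := by
  rw [scaleB_eq, scaleB_eq, add_le_add_iff_left, mul_le_mul_iff_left₀ (one_div_sq_pos hn),
    Nat.cast_le]

theorem scaleB_injective (hn : 2 ≤ n) : Function.Injective (scaleB n) := fun _ _ h =>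
  le_antisymm ((scaleB_le_scaleB_iff hn).mp h.le) ((scaleB_le_scaleB_iff hn).mp h.ge)

theorem three_halves_le_scaleB (hn : 2 ≤ n) (j : ℕ) : 3 / 2 ≤ scaleB n j := by
  have hn' : (2 : ℝ) ≤ n := by exact_mod_cast hn
  have hj : 0 ≤ (j : ℝ) * (1 / (n : ℝ) ^ 2) := by positivity
  rw [scaleB_eq]
  linarith [mul_one_div_sq_le_half hn]

theorem scaleB_sub_le_one (hn : 2 ≤ n) {i : ℕ} (j : ℕ) (hi : i ≤ n + 1) :
    scaleB n i - scaleB n j ≤ 1 := by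
  have hi' := (scaleB_le_scaleB_iff hn).mpr hi
  have hj := (scaleB_le_scaleB_iff hn).mpr (Nat.zero_le j)
  have hε : 1 / (n : ℝ) ^ 2 ≤ 1 / 2 := by
    have hn' : (2 : ℝ) ≤ n := by exact_mod_cast hn
    nlinarith [mul_one_div_sq_le_half hn, one_div_sq_pos hn]
  have h0 : scaleB n 0 = n - n * (1 / (n : ℝ) ^ 2) := by simp [scaleB_eq]
  linarith [scaleB_succ_self n, mul_one_div_sq_le_half hn]

theorem scaleB_lt_two_mul (hn : 2 ≤ n) {j : ℕ} (hj : j ≤ n + 1) : scaleB n j < 2 * scaleB n 0 := by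
  linarith [scaleB_sub_le_one hn 0 hj, three_halves_le_scaleB hn 0]

theorem two_mul_scaleB_le_witnessRadius (hn : 2 ≤ n) (i j : Fin (n + 1)) :
    2 * scaleB n 0 ≤ witnessRadius i (some j) := by
  linarith [(scaleB_le_scaleB_iff hn).mpr (Nat.zero_le (attachIndex i j)),
    show witnessRadius i (some j) = scaleB n 0 + scaleB n (attachIndex i j) from rfl]

theorem scaleB_le_witnessRadius (hn : 2 ≤ n) (i : Fin (n + 1)) (m : Option (Fin (n + 1))) :
    scaleB n 0 ≤ witnessRadius i m := by
  rcases m with _ | j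
  · exact le_rfl
  · linarith [two_mul_scaleB_le_witnessRadius hn i j, three_halves_le_scaleB hn 0]

theorem witnessTilt_nonneg (hn : 2 ≤ n) (i : Fin (n + 1)) (m : Option (Fin (n + 1))) :
    0 ≤ witnessTilt i m := by
  rcases m with _ | j
  · exact le_rfl
  · have h0 := three_halves_le_scaleB hn 0
    have hi := three_halves_le_scaleB hn (i + 1)
    simp only [witnessTilt]
    split_ifs <;> positivity

theorem witnessTilt_le_one (hn : 2 ≤ n) (i : Fin (n + 1)) (m : Option (Fin (n + 1))) :
    witnessTilt i m ≤ 1 := by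
  rcases m with _ | j
  · exact zero_le_one
  simp only [witnessTilt]
  split_ifs
  · have hi : scaleB n 0 + scaleB n (i + 1) ≤ 2 * n := by
      have hi' := (scaleB_le_scaleB_iff hn).mpr (Nat.succ_le_succ (Nat.lt_succ_iff.mp i.2))
      have h0 : scaleB n 0 = n - n * (1 / (n : ℝ) ^ 2) := by simp [scaleB_eq]
      have hn' : (2 : ℝ) ≤ n := by exact_mod_cast hn
      nlinarith [scaleB_succ_self n, one_div_sq_pos hn]
    calc (scaleB n 0 + scaleB n (i + 1)) * (1 / (n : ℝ) ^ 2)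
        ≤ 2 * (n : ℝ) * (1 / (n : ℝ) ^ 2) := mul_le_mul_of_nonneg_right hi (one_div_sq_pos hn).le
      _ ≤ 1 := by linarith [mul_one_div_sq_le_half hn]
  · exact zero_le_one

theorem abs_height_sub_le_iff (hn : 2 ≤ n) {s : ℕ} (hs : s ≤ n + 1) (i i' : Fin (n + 1)) :
    |((n : ℝ) + 1 / (n : ℝ) ^ 2) * (i : ℕ) - (n + 1 / (n : ℝ) ^ 2) * (i' : ℕ)| ≤ scaleB n s ↔
      LayerAdj s i i' := by
  have hs' := (scaleB_le_scaleB_iff hn).mpr hs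
  have hpos := three_halves_le_scaleB hn s
  rw [← scaleB_succ_self, ← mul_sub, abs_mul, abs_of_pos (by linarith : 0 < scaleB n (n + 1))]
  constructor
  · intro h
    by_cases hii : i = i'
    · exact Or.inl hii
    have hne : (i : ℤ) - (i' : ℤ) ≠ 0 := sub_ne_zero.mpr fun h => hii (Fin.ext (by omega))
    have hone : (1 : ℝ) ≤ |((i : ℕ) : ℝ) - ((i' : ℕ) : ℝ)| := by
      exact_mod_cast Int.one_le_abs hne
    have htop : n + 1 ≤ s := (scaleB_le_scaleB_iff hn).mp (by nlinarith)
    have htwo : |((i : ℕ) : ℝ) - ((i' : ℕ) : ℝ)| < 2 := by nlinarith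
    have htwo' : |(i : ℤ) - (i' : ℤ)| < 2 := by exact_mod_cast htwo
    rw [abs_lt] at htwo'
    exact Or.inr ⟨by omega, by omega⟩
  · rintro (rfl | ⟨rfl, h | h⟩)
    · rw [sub_self, abs_zero, mul_zero]
      linarith
    · simp [← h]
    · simp [← h]

theorem slot_same_direction_iff (hn : 2 ≤ n) (s : ℕ) (q : Fin 4) (i i' : Fin (n + 1))
    (m m' : Option (Fin (n + 1))) :
    (|witnessRadius i m - witnessRadius i' m'| ≤ scaleB n s ∧
      |witnessTilt i m - witnessTilt i' m'| ≤ scaleB n s) ↔ SlotAdj s i i' q q m m' := by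
  have hr := three_halves_le_scaleB hn s
  have htilt : |witnessTilt i m - witnessTilt i' m'| ≤ scaleB n s :=
    abs_sub_le_iff.mpr ⟨by linarith [witnessTilt_nonneg hn i' m', witnessTilt_le_one hn i m],
      by linarith [witnessTilt_nonneg hn i m, witnessTilt_le_one hn i' m']⟩
  rw [and_iff_left htilt]
  rcases m with _ | j <;> rcases m' with _ | j'
  · refine iff_of_true ?_ (ne_add_two q)
    rw [witnessRadius, witnessRadius, sub_self, abs_zero]
    linarith
  · change _ ↔ q = q ∧ attachIndex i' j' ≤ s
    rw [← scaleB_le_scaleB_iff hn, witnessRadius, witnessRadius, sub_add_cancel_left, abs_neg,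
      abs_of_pos (by linarith [three_halves_le_scaleB hn (attachIndex i' j')]),
      and_iff_right rfl]
  · change _ ↔ q = q ∧ attachIndex i j ≤ s
    rw [← scaleB_le_scaleB_iff hn, witnessRadius, witnessRadius, add_sub_cancel_left,
      abs_of_pos (by linarith [three_halves_le_scaleB hn (attachIndex i j)]), and_iff_right rfl]
  · refine iff_of_true ?_ rfl
    have h := scaleB_sub_le_one hn (attachIndex i' j') (attachIndex_le i j)
    have h' := scaleB_sub_le_one hn (attachIndex i j) (attachIndex_le i' j')
    rw [witnessRadius, witnessRadius, add_sub_add_left_eq_sub]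
    exact abs_sub_le_iff.mpr ⟨by linarith, by linarith⟩

theorem slot_next_direction_iff (hn : 2 ≤ n) {s : ℕ} (hs : s ≤ n + 1) (q : Fin 4)
    (i i' : Fin (n + 1)) (m m' : Option (Fin (n + 1))) :
    (|witnessRadius i m + witnessTilt i' m'| ≤ scaleB n s ∧
      |witnessRadius i' m' - witnessTilt i m| ≤ scaleB n s) ↔ SlotAdj s i i' q (q + 1) m m' := by
  have hlt := scaleB_lt_two_mul hn hs
  have hone : q + 1 ≠ q := by revert q; decide
  rcases m with _ | j
  · rcases m' with _ | j'
    · have hle := (scaleB_le_scaleB_iff hn).mpr (Nat.zero_le s)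
      have habs : |scaleB n 0| ≤ scaleB n s := by
        rwa [abs_of_pos (by linarith [three_halves_le_scaleB hn 0])]
      have hopp : q + 1 ≠ q + 2 := by revert q; decide
      simpa [witnessRadius, witnessTilt, SlotAdj, hopp] using habs
    · refine iff_of_false (fun h => ?_) (fun h => hone h.1.symm)
      have := (le_abs_self _).trans h.2
      rw [show witnessTilt i none = 0 from rfl] at this
      linarith [two_mul_scaleB_le_witnessRadius hn i' j']
  · refine iff_of_false (fun h => ?_) (fun h => ?_)
    · linarith [(le_abs_self _).trans h.1, two_mul_scaleB_le_witnessRadius hn i j,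
        witnessTilt_nonneg hn i' m']
    · rcases m' with _ | j'
      · exact hone h.1.symm
      · exact hone (Eq.symm h)

theorem dist_witnessPoint_le_iff (hn : 2 ≤ n) {s : ℕ} (hs : s ≤ n + 1) (u v : WitnessIndex n) :
    dist (witnessPoint u) (witnessPoint v) ≤ scaleB n s ↔ WitnessAdj s u v := by
  have hr : 0 ≤ scaleB n s := by linarith [three_halves_le_scaleB hn s]
  have hnext : ∀ (q : Fin 4) (i i' : Fin (n + 1)) (m m' : Option (Fin (n + 1))),
      dist (witnessPoint (i, q, m)) (witnessPoint (i', q + 1, m')) ≤ scaleB n s ↔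
        WitnessAdj s (i, q, m) (i', q + 1, m') := fun q i i' m m' =>
    (dist_dirPoint_next_le_iff hr q).trans
      (and_congr (abs_height_sub_le_iff hn hs i i') (slot_next_direction_iff hn hs q i i' m m'))
  obtain ⟨i, q, m⟩ := u
  obtain ⟨i', q', m'⟩ := v
  have hcases : q' = q ∨ q' = q + 1 ∨ q' = q + 2 ∨ q = q' + 1 := by
    revert q q'
    decide
  rcases hcases with rfl | rfl | rfl | rfl
  · exact (dist_dirPoint_same_le_iff hr q').trans
      (and_congr (abs_height_sub_le_iff hn hs i i') (slot_same_direction_iff hn s q' i i' m m'))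
  · exact hnext q i i' m m'
  · refine (dist_dirPoint_opposite_le_iff hr q).trans (iff_of_false ?_ fun h => h.2.dir_ne rfl)
    rintro ⟨-, h, -⟩
    linarith [(le_abs_self _).trans h, scaleB_lt_two_mul hn hs, scaleB_le_witnessRadius hn i m,
      scaleB_le_witnessRadius hn i' m']
  · rw [dist_comm, hnext q' i' i m' m]
    exact ⟨WitnessAdj.symm, WitnessAdj.symm⟩

theorem eq_of_witnessRadius_eq_of_witnessTilt_eq (hn : 2 ≤ n) {i : Fin (n + 1)}
    {m m' : Option (Fin (n + 1))} (hR : witnessRadius i m = witnessRadius i m')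
    (hT : witnessTilt i m = witnessTilt i m') : m = m' := by
  have h0 := three_halves_le_scaleB hn 0
  rcases m with _ | j <;> rcases m' with _ | j'
  · rfl
  · linarith [two_mul_scaleB_le_witnessRadius hn i j',
      show witnessRadius i none = scaleB n 0 from rfl]
  · linarith [two_mul_scaleB_le_witnessRadius hn i j,
      show witnessRadius i none = scaleB n 0 from rfl]
  have hpos : 0 < (scaleB n 0 + scaleB n (i + 1)) * (1 / (n : ℝ) ^ 2) :=
    mul_pos (by linarith [three_halves_le_scaleB hn (i + 1)]) (one_div_sq_pos hn)
  have hattach := scaleB_injective hn (add_left_cancel hR)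
  simp only [witnessTilt] at hT
  simp only [attachIndex, Fin.val_inj] at hattach
  split_ifs at hT hattach with hj hj' <;> grind

theorem witnessPoint_injective (hn : 2 ≤ n) :
    Function.Injective (witnessPoint : WitnessIndex n → Fin 3 → ℝ) := by
  rintro ⟨i, q, m⟩ ⟨i', q', m'⟩ h
  have hlt (i : Fin (n + 1)) (m : Option (Fin (n + 1))) : witnessTilt i m < witnessRadius i m := by
    linarith [witnessTilt_le_one hn i m, scaleB_le_witnessRadius hn i m,
      three_halves_le_scaleB hn 0]
  obtain ⟨rfl, hR, hT, hz⟩ := (dirPoint_inj (witnessTilt_nonneg hn i m) (hlt i m)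
    (witnessTilt_nonneg hn i' m') (hlt i' m')).mp h
  have hpos : (n : ℝ) + 1 / (n : ℝ) ^ 2 ≠ 0 := by positivity
  obtain rfl : i = i' := Fin.ext (by exact_mod_cast mul_left_cancel₀ hpos hz)
  rw [eq_of_witnessRadius_eq_of_witnessTilt_eq hn hR hT]

/-- The labelling of the points of the witness. -/
noncomputable def witnessEquiv (hn : 2 ≤ n) : WitnessIndex n ≃ witnessSet n :=
  Equiv.ofBijective (fun u => ⟨witnessPoint u, mem_witnessSet_iff.mpr ⟨u, rfl⟩⟩)
    ⟨fun _ _ h => witnessPoint_injective hn (congrArg Subtype.val h), fun p =>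
      let ⟨u, hu⟩ := mem_witnessSet_iff.mp p.2
      ⟨u, Subtype.ext hu⟩⟩

theorem card_witnessSet (hn : 2 ≤ n) : (witnessSet n).card = 4 * (n + 1) * (n + 2) := by
  rw [← Fintype.card_coe, ← Fintype.card_congr (witnessEquiv hn)]
  simp only [Fintype.card_prod, Fintype.card_fin, Fintype.card_option]
  ring

theorem dist_witnessEquiv_le_iff (hn : 2 ≤ n) {s : ℕ} (hs : s ≤ n + 1) (u v : WitnessIndex n) :
    dist (witnessEquiv hn u) (witnessEquiv hn v) ≤ scaleB n s ↔ WitnessAdj s u v :=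
  dist_witnessPoint_le_iff hn hs u v

end WitnessGeometry

/-! ### The homology of the witness -/

section RipsComplexes

variable {X : Type*} [MetricSpace X]

theorem complexNeighbors_ripsFiltration (r : ℝ≥0) (x : X) :
    complexNeighbors (ripsFiltration X r) x = Metric.closedBall x r \ {x} := by
  classical
  ext y
  rw [Set.mem_sdiff, and_comm, Metric.mem_closedBall']
  refine and_congr_right fun _ => ⟨?_, fun h => ⟨{x, y}, ⟨by simp, ?_⟩, by simp⟩⟩
  · rintro ⟨σ, hσ, hσxy⟩
    exact hσ.2 x (Finset.mem_coe.mp (by simp [hσxy])) y (Finset.mem_coe.mp (by simp [hσxy]))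
  · simpa [nndist_comm y x] using h

theorem spansSimplex_degreeRips_iff [Finite X] {p : ℤᵒᵈ × ℝ≥0} {m : ℕ} {t : Fin (m + 1) → X} :
    SpansSimplex (degreeRips X p) t ↔
      (∀ a b, dist (t a) (t b) ≤ p.2) ∧
        ∀ a, OrderDual.ofDual p.1 ≤ ((Metric.closedBall (t a) p.2).ncard : ℤ) := by
  classical
  have hmem (σ : Finset X) : σ ∈ degreeRips X p ↔
      (σ.Nonempty ∧ ∀ x ∈ σ, ∀ y ∈ σ, dist x y ≤ p.2) ∧
        ∀ x ∈ σ, OrderDual.ofDual p.1 ≤ ((Metric.closedBall x p.2).ncard : ℤ) := by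
    refine and_congr Iff.rfl (forall₂_congr fun x _ => ?_)
    have hcard := Set.ncard_sdiff_singleton_add_one
      (Metric.mem_closedBall_self (x := x) (NNReal.coe_nonneg p.2))
    rw [complexNeighbors_ripsFiltration, ← hcard, sub_le_iff_le_add]
    norm_cast
  constructor
  · rintro ⟨σ, hσ, hσt⟩
    have ht (a) : t a ∈ σ := Finset.mem_coe.mp (hσt ▸ Set.mem_range_self a)
    obtain ⟨⟨-, hdist⟩, hdeg⟩ := (hmem σ).mp hσ
    exact ⟨fun a b => hdist _ (ht a) _ (ht b), fun a => hdeg _ (ht a)⟩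
  · rintro ⟨hdist, hdeg⟩
    refine ⟨Finset.univ.image t, (hmem _).mpr ⟨⟨⟨t 0, by simp⟩, ?_⟩, ?_⟩, by simp⟩
    · simpa using hdist
    · simpa using hdeg

end RipsComplexes

section WitnessHomology

variable {F : Type*} [Field F] {n : ℕ} {p : Fin (n + 2) × Fin (n + 2)}

theorem ncard_attachIndex_le (i : Fin (n + 1)) {s : ℕ} (hs : s ≤ n) :
    {j : Fin (n + 1) | attachIndex i j ≤ s}.ncard = if s = i then s else s + 1 := by
  have hset : {j : Fin (n + 1) | attachIndex i j ≤ s} =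
      ({j | (j : ℕ) < if s = i then s else s + 1} : Finset (Fin (n + 1))) := by
    ext j
    simp only [attachIndex, Set.mem_ofPred_eq, Finset.coe_filter, Finset.mem_univ, true_and]
    split_ifs <;> omega
  rw [hset, Set.ncard_coe_finset, Fin.card_filter_val_lt]
  split_ifs <;> omega

/-- The closed neighbourhood of a point of an inner square within its layer. -/
def squareNeighborhood (s : ℕ) (i : Fin (n + 1)) (q : Fin 4) : Set (WitnessIndex n) :=
  (fun q' => (i, q', none)) '' {q' | q' ≠ q + 2} ∪
    (fun j : Fin (n + 1) => (i, q, some j)) '' {j | attachIndex i j ≤ s}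

theorem ncard_squareNeighborhood (s : ℕ) (i : Fin (n + 1)) (q : Fin 4) :
    (squareNeighborhood s i q).ncard = 3 + {j : Fin (n + 1) | attachIndex i j ≤ s}.ncard := by
  have hdisj : Disjoint ((fun q' => ((i, q', none) : WitnessIndex n)) '' {q' | q' ≠ q + 2})
      ((fun j => (i, q, some j)) '' {j | attachIndex i j ≤ s}) := by
    rw [Set.disjoint_left]
    rintro _ ⟨q', -, rfl⟩ ⟨j, -, h⟩
    simp at h
  have hthree : {q' : Fin 4 | q' ≠ q + 2}.ncard = 3 := by
    rw [← Set.compl_singleton_eq, Set.ncard_compl, Set.ncard_singleton, Nat.card_fin]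
  rw [squareNeighborhood, Set.ncard_union_eq hdisj,
    Set.ncard_image_of_injective _ fun _ _ h => by simpa using h,
    Set.ncard_image_of_injective _ fun _ _ h => by simpa using h, hthree]

theorem squareNeighborhood_subset (s : ℕ) (i : Fin (n + 1)) (q : Fin 4) :
    squareNeighborhood s i q ⊆ {v | WitnessAdj s (i, q, none) v} := by
  rintro _ (⟨q', hq, rfl⟩ | ⟨j, hj, rfl⟩)
  · exact ⟨Or.inl rfl, hq⟩
  · exact ⟨Or.inl rfl, rfl, hj⟩

theorem setOf_witnessAdj_eq_squareNeighborhood {s : ℕ} (hs : s ≤ n) (i : Fin (n + 1))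
    (q : Fin 4) : {v | WitnessAdj s (i, q, none) v} = squareNeighborhood s i q := by
  refine (squareNeighborhood_subset s i q).antisymm' ?_
  rintro ⟨i', q', _ | j⟩ ⟨hlayer, hslot⟩ <;> obtain rfl : i = i' := hlayer.eq hs
  · exact Or.inl ⟨q', hslot, rfl⟩
  · obtain ⟨rfl, hj⟩ : q = q' ∧ attachIndex i j ≤ s := hslot
    exact Or.inr ⟨j, hj, rfl⟩

theorem witnessPresent_square_iff (hp : (p.2 : ℕ) ≤ n)
    (i : Fin (n + 1)) (q : Fin 4) : WitnessPresent p (i, q, none) ↔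
      n < (p.1 : ℕ) + p.2 ∨ ((p.1 : ℕ) + p.2 = n ∧ (p.2 : ℕ) ≠ i) := by
  rw [WitnessPresent, setOf_witnessAdj_eq_squareNeighborhood hp, ncard_squareNeighborhood,
    ncard_attachIndex_le i hp]
  split_ifs <;> omega

theorem witnessPresent_square_of_eq (hp : (p.2 : ℕ) = n + 1)
    (i : Fin (n + 1)) (q : Fin 4) : WitnessPresent p (i, q, none) := by
  have hall : {j : Fin (n + 1) | attachIndex i j ≤ p.2} = Set.univ :=
    Set.eq_univ_of_forall fun j => by
      rw [Set.mem_ofPred_eq, hp]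
      exact attachIndex_le i j
  have hle := Set.ncard_le_ncard (squareNeighborhood_subset (p.2 : ℕ) i q) (Set.toFinite _)
  rw [ncard_squareNeighborhood, hall, Set.ncard_univ, Nat.card_fin] at hle
  rw [WitnessPresent]
  omega

/-- The degree-Rips complexes of the witness over the subgrid. -/
noncomputable def witnessFiltration (n : ℕ) :
    Fin (n + 2) × Fin (n + 2) →o PreAbstractSimplicialComplex (witnessSet n) :=
  (degreeRips (witnessSet n)).comp (subgrid n 1)

theorem spansSimplex_witnessFiltration_iff (hn : 2 ≤ n) {m : ℕ}
    {t : Fin (m + 1) → WitnessIndex n} :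
    SpansSimplex (witnessFiltration n p) (fun a => witnessEquiv hn (t a)) ↔
      ∀ a b, WitnessEdge p (t a) (t b) := by
  have hs : (p.2 : ℕ) ≤ n + 1 := Nat.lt_succ_iff.mp p.2.2
  have hr : (((subgrid n 1 p).2 : ℝ≥0) : ℝ) = scaleB n p.2 := by
    change ((1 * (scaleB n p.2).toNNReal : ℝ≥0) : ℝ) = _
    rw [one_mul, Real.coe_toNNReal _ (by linarith [three_halves_le_scaleB hn p.2])]
  have hball (u : WitnessIndex n) : Metric.closedBall (witnessEquiv hn u) (scaleB n p.2) =
      witnessEquiv hn '' {v | WitnessAdj p.2 u v} := by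
    ext y
    obtain ⟨v, rfl⟩ := (witnessEquiv hn).surjective y
    rw [Metric.mem_closedBall', dist_witnessEquiv_le_iff hn hs,
      (witnessEquiv hn).injective.mem_set_image, Set.mem_ofPred_eq]
  have hdeg (u : WitnessIndex n) : OrderDual.ofDual (subgrid n 1 p).1 ≤
      ((Metric.closedBall (witnessEquiv hn u) (scaleB n p.2)).ncard : ℤ) ↔ WitnessPresent p u := by
    rw [hball, Set.ncard_image_of_injective _ (witnessEquiv hn).injective, WitnessPresent]
    change (n : ℤ) + 4 - (p.1 : ℕ) ≤ _ ↔ _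
    omega
  refine spansSimplex_degreeRips_iff.trans ?_
  simp only [hr, dist_witnessEquiv_le_iff hn hs, hdeg]
  exact ⟨fun h a b => ⟨h.1 a b, h.2 a, h.2 b⟩,
    fun h => ⟨fun a b => (h a b).1, fun a => (h a a).2.1⟩⟩

theorem spansSimplex_pair_witnessFiltration_iff (hn : 2 ≤ n)
    {u v : WitnessIndex n} :
    SpansSimplex (witnessFiltration n p) ![witnessEquiv hn u, witnessEquiv hn v] ↔
      WitnessEdge p u v := by
  have ht : ![witnessEquiv hn u, witnessEquiv hn v] = fun a => witnessEquiv hn (![u, v] a) :=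
    funext fun a => by fin_cases a <;> rfl
  rw [ht, spansSimplex_witnessFiltration_iff]
  refine ⟨fun h => h 0 1, fun h => ?_⟩
  simp [Fin.forall_fin_two, h, h.symm, h.refl, h.symm.refl]

theorem isCocycle_witnessFiltration_iff (hn : 2 ≤ n)
    {p : Fin (n + 2) × Fin (n + 2)} {f : witnessSet n → witnessSet n → F} :
    IsCocycle (witnessFiltration n p) f ↔
      IsFlagCocycle (WitnessEdge p) fun u v => f (witnessEquiv hn u) (witnessEquiv hn v) := by
  have hspan (u v w : WitnessIndex n) : SpansSimplex (witnessFiltration n p)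
      ![witnessEquiv hn u, witnessEquiv hn v, witnessEquiv hn w] ↔
        WitnessEdge p u v ∧ WitnessEdge p v w ∧ WitnessEdge p u w := by
    have ht : ![witnessEquiv hn u, witnessEquiv hn v, witnessEquiv hn w] =
        fun a => witnessEquiv hn (![u, v, w] a) := funext fun a => by fin_cases a <;> rfl
    rw [ht, spansSimplex_witnessFiltration_iff]
    refine ⟨fun h => ⟨h 0 1, h 1 2, h 0 2⟩, fun ⟨huv, hvw, huw⟩ => ?_⟩
    simp [Fin.forall_fin_succ, huv, hvw, huw, huv.symm, hvw.symm, huw.symm, huv.refl,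
      hvw.refl, hvw.symm.refl]
  simp only [IsCocycle, (witnessEquiv hn).surjective.forall, hspan, IsFlagCocycle, and_imp]

/-- The cocycle of the `4`-cycle of directions, with the weight `c i` on the layer `i`. -/
noncomputable def witnessCocycle (hn : 2 ≤ n) (c : Fin (n + 1) → F) (x y : witnessSet n) : F :=
  c ((witnessEquiv hn).symm x).1 *
    squareCocycle F ((witnessEquiv hn).symm x).2.1 ((witnessEquiv hn).symm y).2.1

theorem witnessCocycle_apply (hn : 2 ≤ n) (c : Fin (n + 1) → F) (u v : WitnessIndex n) :
    witnessCocycle hn c (witnessEquiv hn u) (witnessEquiv hn v) =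
      c u.1 * squareCocycle F u.2.1 v.2.1 := by
  simp [witnessCocycle]

theorem sum_mul_witnessCocycle_single (hn : 2 ≤ n) (c : Fin (n + 1) → F) :
    (fun x y => ∑ i, c i * witnessCocycle hn (Pi.single i 1) x y) = witnessCocycle hn c := by
  funext x y
  simp [witnessCocycle, Pi.single_apply]

/-- A weight on the layers which is constant along the edges of the complex at `p`. -/
def IsLayerWeight {A : Type*} (p : Fin (n + 2) × Fin (n + 2)) (c : Fin (n + 1) → A) : Prop :=
  ∀ i i', LayerAdj p.2 i i' → c i = c i'

theorem isLayerWeight_of_le {A : Type*} (hp : (p.2 : ℕ) ≤ n) (c : Fin (n + 1) → A) :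
    IsLayerWeight p c :=
  fun _ _ h => congrArg c (h.eq hp)

theorem isLayerWeight_one {A : Type*} [One A] : IsLayerWeight p (1 : Fin (n + 1) → A) :=
  fun _ _ _ => rfl

theorem IsLayerWeight.isCocycle_witnessCocycle (hn : 2 ≤ n) {c : Fin (n + 1) → F}
    (hc : IsLayerWeight p c) : IsCocycle (witnessFiltration n p) (witnessCocycle hn c) := by
  refine (isCocycle_witnessFiltration_iff hn).mpr fun u v w huv hvw huw => ?_
  simp only [witnessCocycle_apply, ← hc _ _ huv.1.1]
  rw [← mul_add, isFlagCocycle_squareCocycle _ _ _ huv.1.2.dir_ne hvw.1.2.dir_ne huw.1.2.dir_ne]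

theorem cocycleEval_witnessCocycle_eq_sum (hn : 2 ≤ n) (hp : (p.2 : ℕ) ≤ n)
    (c : Fin (n + 1) → F) (x : SimplicialHomology F (witnessFiltration n p) 1) :
    cocycleEval (witnessFiltration n p) (witnessCocycle hn c) x =
      ∑ i, c i * cocycleEval (witnessFiltration n p) (witnessCocycle hn (Pi.single i 1)) x := by
  rw [← IsCocycle.cocycleEval_sum_mul
    (fun i => (isLayerWeight_of_le hp _).isCocycle_witnessCocycle hn),
    sum_mul_witnessCocycle_single]

theorem IsLayerWeight.cocycleEval_witnessCocycle_eq_zero (hn : 2 ≤ n) {c : Fin (n + 1) → F}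
    (hc : IsLayerWeight p c) (habsent : ∀ i q, WitnessPresent p (i, q, none) → c i = 0) :
    cocycleEval (witnessFiltration n p) (witnessCocycle hn c) = 0 := by
  refine (hc.isCocycle_witnessCocycle hn).cocycleEval_eq_zero
    ((witnessEquiv hn).surjective.forall₂.mpr fun u v huv => ?_)
  obtain ⟨⟨-, hslot⟩, hpres, -⟩ := (spansSimplex_pair_witnessFiltration_iff hn).mp huv
  obtain ⟨i, q, _ | j⟩ := u
  · rw [witnessCocycle_apply, habsent i q hpres, zero_mul]
  · rw [witnessCocycle_apply, ← hslot.dir_eq, squareCocycle_self, mul_zero]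

theorem eq_zero_of_forall_cocycleEval_single_eq_zero (hn : 2 ≤ n) (hp : (p.2 : ℕ) ≤ n)
    {x : SimplicialHomology F (witnessFiltration n p) 1}
    (hx : ∀ i, cocycleEval (witnessFiltration n p) (witnessCocycle hn (Pi.single i 1)) x = 0) :
    x = 0 := by
  refine eq_zero_of_cocycleEval_eq_zero
    (fun i => (isLayerWeight_of_le hp _).isCocycle_witnessCocycle hn) (fun f hf => ?_) hx
  obtain ⟨c, g, hg⟩ :=
    ((isCocycle_witnessFiltration_iff hn).mp hf).exists_cohomologous_of_le hp
  refine ⟨c, fun y => g ((witnessEquiv hn).symm y), ?_⟩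
  rw [sum_mul_witnessCocycle_single]
  refine (witnessEquiv hn).surjective.forall₂.mpr fun u v huv => ?_
  simpa only [witnessCocycle_apply, Equiv.symm_apply_apply] using
    hg u v ((spansSimplex_pair_witnessFiltration_iff hn).mp huv)

theorem eq_zero_of_cocycleEval_one_eq_zero (hn : 2 ≤ n) (hp : (p.2 : ℕ) = n + 1)
    {x : SimplicialHomology F (witnessFiltration n p) 1}
    (hx : cocycleEval (witnessFiltration n p) (witnessCocycle hn 1) x = 0) : x = 0 := by
  refine eq_zero_of_cocycleEval_eq_zero (ι := Unit)
    (fun _ => isLayerWeight_one.isCocycle_witnessCocycle hn) (fun f hf => ?_) fun _ => hx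
  obtain ⟨c, g, hg⟩ := ((isCocycle_witnessFiltration_iff hn).mp hf).exists_cohomologous_of_eq hp
    (witnessPresent_square_of_eq hp)
  refine ⟨fun _ => c, fun y => g ((witnessEquiv hn).symm y),
    (witnessEquiv hn).surjective.forall₂.mpr fun u v huv => ?_⟩
  simpa only [Fintype.sum_unique, witnessCocycle_apply, Pi.one_apply, one_mul,
    Equiv.symm_apply_apply] using hg u v ((spansSimplex_pair_witnessFiltration_iff hn).mp huv)

theorem exists_forall_cocycleEval_witnessCocycle_eq (F : Type*) [Field F] (hn : 2 ≤ n)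
    {i : Fin (n + 1)} (hpres : ∀ q, WitnessPresent p (i, q, none)) :
    ∃ x : SimplicialHomology F (witnessFiltration n p) 1, ∀ c : Fin (n + 1) → F,
      IsLayerWeight p c → cocycleEval (witnessFiltration n p) (witnessCocycle hn c) x = c i := by
  have hedge (q : Fin 4) : WitnessEdge p (i, q, none) (i, q + 1, none) := by
    have hne : ∀ q : Fin 4, q + 1 ≠ q + 2 := by decide
    exact ⟨⟨Or.inl rfl, hne q⟩, hpres q, hpres (q + 1)⟩
  obtain ⟨x, hx⟩ := exists_forall_cocycleEval_eq_sum (F := F) (K := witnessFiltration n p)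
    (fun q => witnessEquiv hn (i, q, none))
    fun q => (spansSimplex_pair_witnessFiltration_iff hn).mpr (hedge q)
  refine ⟨x, fun c hc => ?_⟩
  rw [hx _ (hc.isCocycle_witnessCocycle hn)]
  simp only [witnessCocycle_apply, ← Finset.mul_sum, sum_squareCocycle, mul_one]

/-- The evaluation of a homology class on the cocycles of the single layers. Layer `i` of the
witness is missing over the grid point `(n - i, i)`, so coordinate `k` belongs to layer `n - k`. -/
noncomputable def layerEval (F : Type*) [Field F] (hn : 2 ≤ n) (p : Fin (n + 2) × Fin (n + 2)) :
    SimplicialHomology F (witnessFiltration n p) 1 →ₗ[F] (Fin (n + 1) → F) :=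
  LinearMap.pi fun k =>
    cocycleEval (witnessFiltration n p) (witnessCocycle hn (Pi.single k.rev 1))

/-- The evaluation of a homology class on the cocycle with weight one on every layer. -/
noncomputable def totalEval (F : Type*) [Field F] (hn : 2 ≤ n) (p : Fin (n + 2) × Fin (n + 2)) :
    SimplicialHomology F (witnessFiltration n p) 1 →ₗ[F] F :=
  cocycleEval (witnessFiltration n p) (witnessCocycle hn 1)

theorem layerEval_injective (hn : 2 ≤ n) (hp : (p.2 : ℕ) ≤ n) :
    Function.Injective (layerEval F hn p) := by
  refine (injective_iff_map_eq_zero _).mpr fun x hx => ?_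
  refine eq_zero_of_forall_cocycleEval_single_eq_zero hn hp fun i => ?_
  simpa [layerEval] using congrFun hx i.rev

theorem layerEval_map (hn : 2 ≤ n) {p q : Fin (n + 2) × Fin (n + 2)} (h : p ≤ q)
    (hq : (q.2 : ℕ) ≤ n) (x : SimplicialHomology F (witnessFiltration n p) 1) :
    layerEval F hn q (simplicialHomologyMap F ((witnessFiltration n).monotone h) 1 x) =
      layerEval F hn p x :=
  funext fun _ => ((isLayerWeight_of_le hq _).isCocycle_witnessCocycle hn).cocycleEval_map _ x

theorem totalEval_map (hn : 2 ≤ n) {p q : Fin (n + 2) × Fin (n + 2)} (h : p ≤ q)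
    (x : SimplicialHomology F (witnessFiltration n p) 1) :
    totalEval F hn q (simplicialHomologyMap F ((witnessFiltration n).monotone h) 1 x) =
      totalEval F hn p x :=
  (isLayerWeight_one.isCocycle_witnessCocycle hn).cocycleEval_map _ x

theorem totalEval_eq_sum_layerEval (hn : 2 ≤ n) (hp : (p.2 : ℕ) ≤ n)
    (x : SimplicialHomology F (witnessFiltration n p) 1) :
    totalEval F hn p x = ∑ k, layerEval F hn p x k := by
  rw [totalEval, cocycleEval_witnessCocycle_eq_sum hn hp, ← Equiv.sum_comp Fin.revPerm]
  simp [layerEval]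

theorem totalEval_bijective (hn : 2 ≤ n) (hp : (p.2 : ℕ) = n + 1) :
    Function.Bijective (totalEval F hn p) := by
  refine ⟨(injective_iff_map_eq_zero _).mpr fun x hx => eq_zero_of_cocycleEval_one_eq_zero hn hp hx,
    LinearMap.surjective fun hzero => ?_⟩
  obtain ⟨x, hx⟩ := exists_forall_cocycleEval_witnessCocycle_eq F hn (i := 0)
    (witnessPresent_square_of_eq hp 0)
  exact one_ne_zero ((hx 1 isLayerWeight_one).symm.trans (LinearMap.congr_fun hzero x))

theorem witnessPresent_square_rev_iff (hp : (p.2 : ℕ) ≤ n) (k : Fin (n + 1)) (q : Fin 4) :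
    WitnessPresent p (k.rev, q, none) ↔
      n < (p.1 : ℕ) + p.2 ∨ ((p.1 : ℕ) + p.2 = n ∧ (k : ℕ) ≠ p.1) := by
  rw [witnessPresent_square_iff hp, Fin.val_rev]
  omega

theorem layerEval_apply_eq_zero (hn : 2 ≤ n) (hp : (p.2 : ℕ) ≤ n) {k : Fin (n + 1)}
    (hk : ∀ q, ¬ WitnessPresent p (k.rev, q, none))
    (x : SimplicialHomology F (witnessFiltration n p) 1) : layerEval F hn p x k = 0 := by
  refine LinearMap.congr_fun ((isLayerWeight_of_le hp _).cocycleEval_witnessCocycle_eq_zero hn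
    fun i q hpres => Pi.single_eq_of_ne ?_ _) x
  rintro rfl
  exact hk q hpres

theorem single_mem_range_layerEval (hn : 2 ≤ n) (hp : (p.2 : ℕ) ≤ n) {k : Fin (n + 1)}
    (hk : ∀ q, WitnessPresent p (k.rev, q, none)) (a : F) :
    Pi.single k a ∈ LinearMap.range (layerEval F hn p) := by
  obtain ⟨x, hx⟩ := exists_forall_cocycleEval_witnessCocycle_eq F hn hk
  refine ⟨a • x, funext fun l => ?_⟩
  have hxl : layerEval F hn p x l = Pi.single (M := fun _ => F) l.rev 1 k.rev :=
    hx _ (isLayerWeight_of_le hp _)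
  rw [map_smul, Pi.smul_apply, hxl]
  simp [Pi.single_apply, eq_comm]

theorem mem_range_layerEval_iff (hn : 2 ≤ n) (hp : (p.2 : ℕ) ≤ n) {v : Fin (n + 1) → F} :
    v ∈ LinearMap.range (layerEval F hn p) ↔
      ((p.1 : ℕ) + p.2 < n → v = 0) ∧
        ((p.1 : ℕ) + p.2 = n → ∀ k : Fin (n + 1), (k : ℕ) = p.1 → v k = 0) := by
  constructor
  · rintro ⟨x, rfl⟩
    refine ⟨fun h => funext fun k => ?_, fun h k hk => ?_⟩ <;>
      refine layerEval_apply_eq_zero hn hp (fun q => ?_) x <;>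
      rw [witnessPresent_square_rev_iff hp] <;> omega
  · rintro ⟨hlt, heq⟩
    rw [← Finset.univ_sum_single v]
    refine Submodule.sum_mem _ fun k _ => ?_
    by_cases hk : v k = 0
    · simp [hk]
    refine single_mem_range_layerEval hn hp
      (fun q => (witnessPresent_square_rev_iff hp k q).mpr ?_) _
    have hn_le : n ≤ (p.1 : ℕ) + p.2 := not_lt.mp fun h => hk (congrFun (hlt h) k)
    have hk_ne (h : (p.1 : ℕ) + p.2 = n) : (k : ℕ) ≠ p.1 := fun h' => hk (heq h k h')
    omega

theorem hasZigzagStructure_witnessFiltration (F : Type*) [Field F] (hn : 2 ≤ n) :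
    HasZigzagStructure n (filtrationHomology F (witnessFiltration n) 1) :=
  ⟨layerEval F hn, totalEval F hn,
    fun _ hp => ⟨layerEval_injective hn hp, fun _ => mem_range_layerEval_iff hn hp⟩,
    fun _ hp => totalEval_bijective hn hp,
    fun _ _ h hq x => layerEval_map hn h hq x,
    fun _ _ h hp _ x => (totalEval_map hn h x).trans (totalEval_eq_sum_layerEval hn hp x),
    fun _ _ h _ x => totalEval_map hn h x⟩

end WitnessHomology

/-! ### Čech complexes for the supremum metric -/

section Cech

variable {ι : Type*} [Fintype ι]

theorem biInter_closedBall_nonempty_iff {σ : Finset (ι → ℝ)} {r : ℝ}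
    (hr : 0 ≤ r) (hσ : σ.Nonempty) : (⋂ x ∈ σ, Metric.closedBall x r).Nonempty ↔
      ∀ x ∈ σ, ∀ y ∈ σ, dist x y ≤ 2 * r := by
  simp only [Set.Nonempty, Set.mem_iInter]
  constructor
  · rintro ⟨z, hz⟩ x hx y hy
    linarith [dist_triangle_left x y z, Metric.mem_closedBall.mp (hz x hx),
      Metric.mem_closedBall.mp (hz y hy)]
  · intro h
    -- The balls are boxes: the coordinatewise supremum of their lower corners lies in all of them.
    refine ⟨fun i => σ.sup' hσ fun x => x i - r, fun y hy => ?_⟩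
    refine Metric.mem_closedBall.mpr ((dist_pi_le_iff hr).mpr fun i => ?_)
    rw [Real.dist_eq, abs_sub_le_iff, sub_le_iff_le_add, sub_le_comm]
    refine ⟨Finset.sup'_le _ _ fun x hx => ?_, Finset.le_sup' (fun x => x i - r) hy⟩
    have hxy := (dist_le_pi_dist x y i).trans (h x hx y hy)
    rw [Real.dist_eq] at hxy
    linarith [le_abs_self (x i - y i)]

/-- The doubling of the scale. -/
def doubleScale : ℝ≥0 →o ℝ≥0 where
  toFun r := 2 * r
  monotone' _ _ h := mul_le_mul_right h 2

theorem cechFiltration_eq_ripsFiltration (X : Finset (ι → ℝ)) :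
    cechFiltration X = (ripsFiltration X).comp doubleScale := by
  classical
  refine OrderHom.ext _ _ (funext fun r => PreAbstractSimplicialComplex.ext (Set.ext fun σ => ?_))
  refine and_congr_right fun hσ => ?_
  have h := biInter_closedBall_nonempty_iff (σ := σ.image Subtype.val) r.2 (hσ.image _)
  simp only [Finset.set_biInter_finset_image, Finset.forall_mem_image] at h
  exact h

theorem degreeCech_eq_degreeRips (X : Finset (ι → ℝ)) :
    degreeCech X = (degreeRips X).comp (OrderHom.id.prodMap doubleScale) := by
  rw [degreeCech, cechFiltration_eq_ripsFiltration]
  rfl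

theorem degreeCech_comp_subgrid (n : ℕ) :
    (degreeCech (witnessSet n)).comp (subgrid n (1 / 2)) = witnessFiltration n := by
  have hscale (r : ℝ≥0) : 2 * (1 / 2 * r) = 1 * r := by rw [← mul_assoc]; norm_num
  rw [degreeCech_eq_degreeRips]
  exact OrderHom.ext _ _ (funext fun p =>
    congrArg (degreeRips (witnessSet n)) (Prod.ext rfl (hscale (scaleB n p.2).toNNReal)))

end Cech

/-! ### The size of the diagrams of the witness -/

section Growth

open Filter Asymptotics

theorem subgrid_sup (n : ℕ) (c : ℝ≥0) (a b : Fin (n + 2) × Fin (n + 2)) :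
    subgrid n c (a ⊔ b) = subgrid n c a ⊔ subgrid n c b := by
  have hfst : Monotone fun i => (subgrid n c (i, 0)).1 := fun _ _ h =>
    ((subgrid n c).monotone (Prod.mk_le_mk.mpr ⟨h, le_rfl⟩)).1
  have hsnd : Monotone fun j => (subgrid n c (0, j)).2 := fun _ _ h =>
    ((subgrid n c).monotone (Prod.mk_le_mk.mpr ⟨le_rfl, h⟩)).2
  exact Prod.ext (hfst.map_sup a.1 b.1) (hsnd.map_sup a.2 b.2)

theorem degreeBifiltration_witness_properties (F : Type*) [Field F] {n : ℕ} (hn : 2 ≤ n)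
    {K : ℝ≥0 →o PreAbstractSimplicialComplex (witnessSet n)} {c : ℝ≥0}
    (hK : (degreeBifiltration K).comp (subgrid n c) = witnessFiltration n) :
    HasZigzagStructure n
        ((filtrationHomology F (degreeBifiltration K) 1).restrict (subgrid n c)) ∧
      2 ^ (n + 1) - 1 ≤ gpdSize
        ((filtrationHomology F (degreeBifiltration K) 1).restrict (subgrid n c)) ∧
      (∃ f, IsGPD (filtrationHomology F (degreeBifiltration K) 1) f ∧
        (Function.support f).Finite) ∧
      2 ^ (n + 1) - 1 ≤ gpdSize (filtrationHomology F (degreeBifiltration K) 1) := by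
  have hz : HasZigzagStructure n
      ((filtrationHomology F (degreeBifiltration K) 1).restrict (subgrid n c)) := by
    change HasZigzagStructure n
      (filtrationHomology F ((degreeBifiltration K).comp (subgrid n c)) 1)
    rw [hK]
    exact hasZigzagStructure_witnessFiltration F hn
  have hgpd := exists_isGPD_degreeBifiltration F K 1
  refine ⟨hz, hz.two_pow_le_gpdSize, hgpd,
    two_pow_le_gpdSize_of_restrict (fun a b p ha hb => ?_) hz hgpd⟩
  exact (subgrid_sup n c a b).trans_le (sup_le ha hb)

theorem isLittleO_quadratic_pow_two_pow (k : ℕ) :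
    (fun n : ℕ => ((4 * (n + 1) * (n + 2) : ℕ) : ℝ) ^ k) =o[atTop] fun n => (2 : ℝ) ^ n := by
  have hquadratic : (fun n : ℕ => ((4 * (n + 1) * (n + 2) : ℕ) : ℝ)) =O[atTop]
      fun n : ℕ => (n : ℝ) ^ 2 := by
    refine IsBigO.of_bound 24 ((eventually_ge_atTop 1).mono fun n hn => ?_)
    have hn' : (1 : ℝ) ≤ n := by exact_mod_cast hn
    rw [Real.norm_of_nonneg (by positivity), Real.norm_of_nonneg (by positivity)]
    push_cast
    nlinarith
  refine (hquadratic.pow k).trans_isLittleO ?_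
  simpa only [← pow_mul] using isLittleO_pow_const_const_pow_of_one_lt (R := ℝ) (2 * k) one_lt_two

theorem exists_mul_pow_lt_of_two_pow_le {size : ℕ → ℕ}
    (hsize : ∀ n, 2 ≤ n → 2 ^ (n + 1) - 1 ≤ size n) (k : ℕ) (C : ℝ) (N₀ : ℕ) :
    ∃ n, 2 ≤ n ∧ N₀ ≤ 4 * (n + 1) * (n + 2) ∧
      C * ((4 * (n + 1) * (n + 2) : ℕ) : ℝ) ^ k < size n := by
  have hbound := ((isLittleO_quadratic_pow_two_pow k).const_mul_left C).bound one_pos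
  obtain ⟨n, hn, hn₂, hnN⟩ :=
    (hbound.and ((eventually_ge_atTop 2).and (eventually_ge_atTop N₀))).exists
  refine ⟨n, hn₂, by nlinarith, ?_⟩
  have hlt : 2 ^ n < size n := by
    have hle := hsize n hn₂
    have hone : 1 < 2 ^ n := Nat.one_lt_two_pow (by omega)
    rw [pow_succ] at hle
    omega
  calc _ ≤ ‖C * ((4 * (n + 1) * (n + 2) : ℕ) : ℝ) ^ k‖ := le_abs_self _
    _ ≤ 2 ^ n := by simpa using hn
    _ < size n := by exact_mod_cast hlt

end Growth

theorem mainTheorem3 (F : Type*) [Field F] :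
    -- degree-Rips: the sizes over all finite metric spaces are not polynomially bounded
    (¬ ∃ (k : ℕ) (C : ℝ) (N₀ : ℕ), ∀ (X : Type) [MetricSpace X] [Finite X], N₀ ≤ Nat.card X →
      (gpdSize (filtrationHomology F (degreeRips X) 1) : ℝ) ≤ C * (Nat.card X : ℝ) ^ k) ∧
    -- degree-Čech: the same, already over finite subsets of `ℝ³` with the supremum metric
    (¬ ∃ (k : ℕ) (C : ℝ) (N₀ : ℕ), ∀ X : Finset (Fin 3 → ℝ), N₀ ≤ X.card →
      (gpdSize (filtrationHomology F (degreeCech X) 1) : ℝ) ≤ C * (X.card : ℝ) ^ k) ∧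
    -- explicit witnesses
    (∀ n : ℕ, 2 ≤ n →
      (witnessSet n).card = 4 * (n + 1) * (n + 2) ∧
      (HasZigzagStructure n
          ((filtrationHomology F (degreeRips (witnessSet n)) 1).restrict (subgrid n 1)) ∧
        2 ^ (n + 1) - 1 ≤ gpdSize
          ((filtrationHomology F (degreeRips (witnessSet n)) 1).restrict (subgrid n 1)) ∧
        (∃ f, IsGPD (filtrationHomology F (degreeRips (witnessSet n)) 1) f ∧
          (Function.support f).Finite) ∧
        2 ^ (n + 1) - 1 ≤ gpdSize (filtrationHomology F (degreeRips (witnessSet n)) 1)) ∧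
      (HasZigzagStructure n
          ((filtrationHomology F (degreeCech (witnessSet n)) 1).restrict (subgrid n (1 / 2))) ∧
        2 ^ (n + 1) - 1 ≤ gpdSize
          ((filtrationHomology F (degreeCech (witnessSet n)) 1).restrict (subgrid n (1 / 2))) ∧
        (∃ f, IsGPD (filtrationHomology F (degreeCech (witnessSet n)) 1) f ∧
          (Function.support f).Finite) ∧
        2 ^ (n + 1) - 1 ≤ gpdSize (filtrationHomology F (degreeCech (witnessSet n)) 1))) := by
  have hrips (n : ℕ) (hn : 2 ≤ n) := degreeBifiltration_witness_properties F hn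
    (K := ripsFiltration (witnessSet n)) (c := 1) rfl
  have hcech (n : ℕ) (hn : 2 ≤ n) := degreeBifiltration_witness_properties F hn
    (K := cechFiltration (witnessSet n)) (degreeCech_comp_subgrid n)
  refine ⟨?_, ?_, fun n hn => ⟨card_witnessSet hn, hrips n hn, hcech n hn⟩⟩
  · rintro ⟨k, C, N₀, hbound⟩
    obtain ⟨n, hn, hN, hlt⟩ := exists_mul_pow_lt_of_two_pow_le
      (fun n hn => (hrips n hn).2.2.2) k C N₀
    have hcard : Nat.card (witnessSet n) = 4 * (n + 1) * (n + 2) := by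
      rw [Nat.card_eq_finsetCard, card_witnessSet hn]
    rw [← hcard] at hN hlt
    exact hlt.not_ge (hbound (witnessSet n) hN)
  · rintro ⟨k, C, N₀, hbound⟩
    obtain ⟨n, hn, hN, hlt⟩ := exists_mul_pow_lt_of_two_pow_le
      (fun n hn => (hcech n hn).2.2.2) k C N₀
    rw [← card_witnessSet hn] at hN hlt
    exact hlt.not_ge (hbound (witnessSet n) hN)
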